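/- Let $n\ge 1$ and let $\mathrm{SO}_0(n,1)$ be the identity component of the group of matrices of determinant $1$ preserving the form $\operatorname{diag}\bigl(\mathrm{Id}_{n-1},\begin{smallmatrix}0&1\\1&0\end{smallmatrix}\bigr)$ on $\mathbb R^{n+1}$. Let $\mathbb{RH}(n)$ be the sheet with positive last coordinate of the hyperboloid on which this form takes the value $-2$, with base point $o=(0,-1,1)$. Embed $\mathrm{SO}(n-1)\times\mathbb R_{>0}$ by $(k,\lambda)\mapsto\operatorname{diag}(k,\lambda,\lambda^{-1})$, put $A=\operatorname{diag}(0,\dots,0,1,-1)$, $\mathfrak a=\mathbb RA$, $$\mathfrak n=\left\{\begin{pmatrix}0&0&v\\-v^T&0&0\\0&0&0\end{pmatrix}:v\in\mathbb R^{n-1}\right\},\qquad N=\exp\mathfrak n,\qquad \mathfrak s=\mathfrak a+\mathfrak n .$$ Let $F_r$ be a connected closed subgroup of $\mathrm{SO}(n-1)\mathbb R_{>0}$ with non-trivial projection to $\mathbb R_{>0}$. Then $G=F_rN$ acts transitively on $\mathbb{RH}(n)$, and the isotropy group of $o$ is $H=F_r\cap\mathrm{SO}(n-1)$. Let $\mathfrak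 g,\mathfrak f_r,\mathfrak h$ be the Lie algebras of $G,F_r,H$. Let $\mathfrak h_0$ and $(\mathfrak f_r)_0$ be the centres of $\mathfrak h$ and $\mathfrak f_r$. Let $\mathfrak a_r$ be a one-dimensional complement to $\mathfrak h_0+\mathfrak n$ in $(\mathfrak f_r)_0+\mathfrak n$; it projects non-trivially to $\mathfrak a$. (For instance, $\mathfrak a_r$ can be any line in $\mathfrak f_r$ with $\mathfrak f_r=\mathfrak h\oplus\mathfrak a_r$ and $[\mathfrak h,\mathfrak a_r]=0$.) Put $\mathfrak s_r=\mathfrak a_r+\mathfrak n$, so that $\mathfrak g=\mathfrak h\oplus\mathfrak s_r$. Let $\mathfrak m$ be an $\operatorname{Ad}_H$-invariant complement to $\mathfrak h$ in $\mathfrak g$, given as the graph $\{X+\varphi_r(X):X\in\mathfrak s_r\}$ of an $\mathfrak h$-equivariant linear map $\varphi_r\colon\mathfrak s_r\to\mathfrak h$. Let $\chi_r\colon\mathfrak s\to\mathfrak s_r$ be any $\mathfrak h$-equivariant linear map extending the identity on $\mathfrak n$, and put $\varphi=\varphi_r\circ\chi_r\colon\mathfrak s\to\mathfrak h$. For $C\in\mathfrak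 g$, write $C^*$ for the vector field on $\mathbb{RH}(n)$ whose one-parameter group is the action of $\exp(tC)$. The canonical connection $\widetilde\nabla$ of $\mathfrak g=\mathfrak h+\mathfrak m$ is the smooth $G$-invariant affine connection on $\mathbb{RH}(n)$ such that $$(\widetilde\nabla_{B^*}C^*)_o=-([B,C]_{\mathfrak m})^*_o\qquad\text{for all }B\in\mathfrak m,\ C\in\mathfrak g,$$ where $[B,C]_{\mathfrak m}$ is the $\mathfrak m$-component of $[B,C]\in\mathfrak h\oplus\mathfrak m$. Its holonomy algebra $\mathfrak{hol}$ is the Lie subalgebra of $\operatorname{End}(T_o\mathbb{RH}(n))$ generated by the curvature endomorphisms $\widetilde R_{X,Y}$, $X,Y\in T_o\mathbb{RH}(n)$. Then such a connection $\widetilde\nabla$ exists, the isotropy representation $\mathfrak h\to\operatorname{End}(T_o\mathbb{RH}(n))$ is faithful, and, when $\mathfrak h$ is regarded as a subalgebra of $\operatorname{End}(T_o\mathbb{RH}(n))$ through it, $$\mathfrak{hol}=\varphi_r(\mathfrak n)=\varphi(\mathfrak n).$$ -/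

import Mathlib

open scoped Manifold ContDiff Matrix

attribute [local instance 100] LieRing.ofAssociativeRing

namespace RHHol

noncomputable section

/-! ### Connections, curvature and the holonomy algebra on a manifold -/

section Manifold

variable {E : Type*} [NormedAddCommGroup E] [NormedSpace ℝ E]
  {H : Type*} [TopologicalSpace H] {I : ModelWithCorners ℝ E H}
  {M : Type*} [TopologicalSpace M] [ChartedSpace H M] [IsManifold I ∞ M]

/-- A smooth vector field on `M`. -/
def IsSmoothField (X : Π x : M, TangentSpace I x) : Prop :=
  CMDiff ∞ (T% X)

/-- The curvature `R(X, Y) Z = ∇_X ∇_Y Z - ∇_Y ∇_X Z - ∇_[X,Y] Z` of an affine connection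
(in Mathlib's notation `cov Z x (X x)` is `(∇_X Z)(x)`). -/
def curvature (cov : CovariantDerivative I E (TangentSpace I : M → Type _))
    (X Y Z : Π x : M, TangentSpace I x) (x : M) : TangentSpace I x :=
  cov (fun y => cov Z y (Y y)) x (X x) - cov (fun y => cov Z y (X y)) x (Y x)
    - cov Z x (VectorField.mlieBracket I X Y x)

/-- The holonomy algebra at `p` : the Lie algebra of endomorphisms of `T_p M` generated by the
curvature endomorphisms `R_{X,Y}`, `X, Y ∈ T_p M`. The endomorphism `R_{X,Y}` is the map
`Z(p) ↦ (R(X, Y) Z)(p)`, where tangent vectors at `p` are extended to smooth vector fields. -/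
def holonomyAlgebra (cov : CovariantDerivative I E (TangentSpace I : M → Type _)) (p : M) :
    LieSubalgebra ℝ (Module.End ℝ (TangentSpace I p)) :=
  LieSubalgebra.lieSpan ℝ _
    {T | ∃ X Y : Π x : M, TangentSpace I x, IsSmoothField X ∧ IsSmoothField Y ∧
      ∀ Z : Π x : M, TangentSpace I x, IsSmoothField Z → T (Z p) = curvature cov X Y Z p}

end Manifold

/-! ### Matrices preserving the form `diag(Id, (0 1; 1 0))`; throughout `n = m + 1` -/

/-- The index set of the standard basis of `ℝ^{n+1} = ℝ^{n-1} ⊕ ℝ²`, where `n = m + 1`. -/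
abbrev Idx (m : ℕ) : Type := Fin m ⊕ Fin 2

/-- Real square matrices of size `n + 1 = m + 2`. -/
abbrev Mat (m : ℕ) : Type := Matrix (Idx m) (Idx m) ℝ

/-- The invertible matrices of size `n + 1 = m + 2`. -/
abbrev GLn (m : ℕ) : Type := GL (Idx m) ℝ

/-- The Gram matrix `diag(Id_{n-1}, (0 1; 1 0))` of the Lorentzian form. -/
def lorentz (m : ℕ) : Mat m := Matrix.fromBlocks 1 0 0 !![0, 1; 1, 0]

/-- The embedding `(k, lam) ↦ diag(k, lam, lam⁻¹)` of `SO(n-1) × ℝ_{>0}`. -/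
def leviHom (m : ℕ) :
    Matrix.specialOrthogonalGroup (Fin m) ℝ × {r : ℝ // 0 < r} →* GLn m :=
  MonoidHom.toHomUnits
    { toFun := fun x => Matrix.fromBlocks (x.1 : Matrix (Fin m) (Fin m) ℝ) 0 0
        !![(x.2 : ℝ), 0; 0, (x.2 : ℝ)⁻¹]
      map_one' := by
        have h : (!![(1 : ℝ), 0; 0, 1] : Matrix (Fin 2) (Fin 2) ℝ) = 1 := by
          ext i j; fin_cases i <;> fin_cases j <;> simp
        simp [h]
      map_mul' := fun x y => by
        simp [Matrix.fromBlocks_multiply, mul_comm] }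

/-- The subgroup `SO(n-1) ℝ_{>0}`. -/
def leviGroup (m : ℕ) : Subgroup (GLn m) := (leviHom m).range

/-- The subgroup `SO(n-1)`. -/
def rotGroup (m : ℕ) : Subgroup (GLn m) :=
  ((leviHom m).comp (MonoidHom.inl _ _)).range

/-- The standard generator `diag(0, …, 0, 1, -1)` of `𝔞`. -/
def genA (m : ℕ) : Mat m := Matrix.fromBlocks 0 0 0 !![1, 0; 0, -1]

/-- The Lie algebra `𝔞`. -/
def lieA (m : ℕ) : Submodule ℝ (Mat m) := Submodule.span ℝ {genA m}

/-- The matrix with rows `(0, 0, v)`, `(-vᵀ, 0, 0)`, `(0, 0, 0)`, as a linear function of `v`. -/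
def nilMat (m : ℕ) : (Fin m → ℝ) →ₗ[ℝ] Mat m where
  toFun v := Matrix.fromBlocks 0 (Matrix.of fun i => ![0, v i]) (Matrix.of ![fun j => -v j, 0]) 0
  map_add' v w := by
    ext (i | i) (j | j)
    · simp
    · fin_cases j <;> simp
    · fin_cases i <;> simp [add_comm]
    · simp
  map_smul' c v := by
    ext (i | i) (j | j)
    · simp
    · fin_cases j <;> simp
    · fin_cases i <;> simp
    · simp

/-- The Lie algebra `𝔫`. -/
def lieN (m : ℕ) : Submodule ℝ (Mat m) := LinearMap.range (nilMat m)

/-- The nilpotent Iwasawa factor `N`, generated by the exponentials of elements of `𝔫`. -/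
def nilGroup (m : ℕ) : Subgroup (GLn m) :=
  Subgroup.closure {g | ∃ X ∈ lieN m, (g : Mat m) = NormedSpace.exp X}

/-- The Lie algebra of a matrix group `G` : it is generated by the matrices `X` with
`exp(tX) ∈ G` for all real `t`. For a closed subgroup `G` these matrices already form a
Lie algebra. -/
def lieAlg {m : ℕ} (G : Subgroup (GLn m)) : LieSubalgebra ℝ (Mat m) :=
  LieSubalgebra.lieSpan ℝ _ {X | ∀ t : ℝ, ∃ g ∈ G, (g : Mat m) = NormedSpace.exp (t • X)}

/-- The centre of a Lie algebra of matrices, as a subspace of the space of matrices. -/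
def lieCenter {m : ℕ} (L : LieSubalgebra ℝ (Mat m)) : Submodule ℝ (Mat m) :=
  (LieAlgebra.center ℝ L).toSubmodule.map L.toSubmodule.subtype

/-! ### Real hyperbolic space -/

/-- The quadratic form of `lorentz m`. -/
def lorentzForm {m : ℕ} (x : Idx m → ℝ) : ℝ := x ⬝ᵥ (lorentz m *ᵥ x)

/-- The sheet of the hyperboloid `{Q = -2}` on which the last coordinate is positive. -/
def hyperboloid (m : ℕ) : Set (Idx m → ℝ) :=
  {x | lorentzForm x = -2 ∧ 0 < x (Sum.inr 1)}

/-- `RH(n)`, `n = m + 1`, in horospherical coordinates `(x, t)`; these are global coordinates on the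
hyperboloid, see `toHyperboloid` and `bijOn_toHyperboloid`. -/
abbrev RH (m : ℕ) : Type := (Fin m → ℝ) × ℝ

/-- The parametrization `(x, t) ↦ (e^{-t} x, -(e^t + e^{-t} |x|² / 2), e^{-t})`. -/
def toHyperboloid {m : ℕ} (u : RH m) : Idx m → ℝ :=
  Sum.elim (fun i => Real.exp (-u.2) * u.1 i)
    ![-(Real.exp u.2 + Real.exp (-u.2) * (u.1 ⬝ᵥ u.1) / 2), Real.exp (-u.2)]

/-- The horospherical coordinates `(w / q, -log q)` of a point `(w, p, q)`. -/
def ofHyperboloid {m : ℕ} (y : Idx m → ℝ) : RH m :=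
  (fun i => y (Sum.inl i) / y (Sum.inr 1), -Real.log (y (Sum.inr 1)))

theorem lorentzForm_eq {m : ℕ} (x : Idx m → ℝ) :
    lorentzForm x = (∑ i, x (Sum.inl i) ^ 2) + 2 * x (Sum.inr 0) * x (Sum.inr 1) := by
  simp [lorentzForm, lorentz, dotProduct, Matrix.mulVec, Fintype.sum_sum_type, Fin.sum_univ_two,
    Matrix.one_apply, pow_two]
  ring

theorem ofHyperboloid_toHyperboloid {m : ℕ} (u : RH m) :
    ofHyperboloid (toHyperboloid u) = u := by
  refine Prod.ext (funext fun i => ?_) ?_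
  · simp [ofHyperboloid, toHyperboloid]
  · simp [ofHyperboloid, toHyperboloid]

theorem toHyperboloid_mem {m : ℕ} (u : RH m) : toHyperboloid u ∈ hyperboloid m := by
  refine ⟨?_, by simp [toHyperboloid, Real.exp_pos]⟩
  have h : Real.exp u.2 * Real.exp (-u.2) = 1 := by rw [← Real.exp_add]; simp
  rw [lorentzForm_eq]
  simp only [toHyperboloid, Sum.elim_inl, Sum.elim_inr, mul_pow, ← Finset.mul_sum,
    Matrix.cons_val_zero, Matrix.cons_val_one, dotProduct, ← pow_two]
  linear_combination (-2) * h

theorem toHyperboloid_ofHyperboloid {m : ℕ} {y : Idx m → ℝ} (hy : y ∈ hyperboloid m) :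
    toHyperboloid (ofHyperboloid y) = y := by
  obtain ⟨h1, h2⟩ := hy
  rw [lorentzForm_eq] at h1
  have e : Real.exp (-(ofHyperboloid y).2) = y (Sum.inr 1) := by
    simp [ofHyperboloid, Real.exp_log h2]
  have e' : Real.exp ((ofHyperboloid y).2) = (y (Sum.inr 1))⁻¹ := by
    simp [ofHyperboloid, Real.exp_neg, Real.exp_log h2]
  have hs : ((ofHyperboloid y).1 ⬝ᵥ (ofHyperboloid y).1)
      = (∑ i, y (Sum.inl i) ^ 2) / y (Sum.inr 1) ^ 2 := by
    simp [ofHyperboloid, dotProduct, Finset.sum_div, div_mul_div_comm, pow_two]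
  funext j
  rcases j with i | j
  · simp only [toHyperboloid, e, Sum.elim_inl]
    simp only [ofHyperboloid]
    field_simp
  · fin_cases j
    · simp only [toHyperboloid, e, e', hs, Sum.elim_inr]
      simp
      field_simp
      linarith
    · simp [toHyperboloid, e]

/-- The horospherical coordinates parametrize the hyperboloid bijectively. -/
theorem bijOn_toHyperboloid (m : ℕ) :
    Set.BijOn (toHyperboloid (m := m)) Set.univ (hyperboloid m) :=
  ⟨fun u _ => toHyperboloid_mem u,
    fun u _ v _ h => by
      rw [← ofHyperboloid_toHyperboloid u, ← ofHyperboloid_toHyperboloid v, h],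
    fun y hy => ⟨ofHyperboloid y, Set.mem_univ _, toHyperboloid_ofHyperboloid hy⟩⟩

/-- The linear action of (orthochronous Lorentz) matrices on the hyperboloid, in coordinates. -/
def act {m : ℕ} (g : Mat m) (u : RH m) : RH m := ofHyperboloid (g *ᵥ toHyperboloid u)

/-- The base point, which corresponds to `(0, -1, 1)` on the hyperboloid. -/
def basePt (m : ℕ) : RH m := (0, 0)

theorem toHyperboloid_basePt (m : ℕ) :
    toHyperboloid (basePt m) = Sum.elim (fun _ => 0) ![-1, 1] := by
  simp [toHyperboloid, basePt]

/-- The tangent space of `RH(n)`. -/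
abbrev Tan {m : ℕ} (u : RH m) : Type := TangentSpace 𝓘(ℝ, RH m) u

/-- Affine connections on `RH(n)`, i.e. covariant derivatives on its tangent bundle. -/
abbrev AffConn (m : ℕ) : Type :=
  CovariantDerivative 𝓘(ℝ, RH m) (RH m) (TangentSpace 𝓘(ℝ, RH m) : RH m → Type _)

/-- The differential of the action of `g` at `u`. -/
def actDeriv {m : ℕ} (g : Mat m) (u : RH m) : Tan u →L[ℝ] Tan (act g u) :=
  mfderiv 𝓘(ℝ, RH m) 𝓘(ℝ, RH m) (act g) u

/-- The vector field on `RH(n)` whose one-parameter group is the action of `exp(tC)`. -/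
def fundField {m : ℕ} (C : Mat m) (u : RH m) : Tan u :=
  deriv (fun t : ℝ => act (NormedSpace.exp (t • C)) u) 0

/-- The isotropy representation of an element `C` of the isotropy algebra on `T_o RH(n)` :
the derivative at `t = 0` of the differential of `exp(tC)` at the fixed point `o`. -/
def isotropyRep {m : ℕ} (C : Mat m) : Module.End ℝ (Tan (basePt m)) :=
  ((deriv (fun t : ℝ => fderiv ℝ (act (NormedSpace.exp (t • C))) (basePt m)) 0 :
    RH m →L[ℝ] RH m) : RH m →ₗ[ℝ] RH m)

/-! ### The groups `F_r N` and their reductive decompositions -/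

/-- `F` is a connected closed subgroup of `SO(n-1) ℝ_{>0}` with non-trivial projection to
`ℝ_{>0}`. -/
structure IsFactor {m : ℕ} (F : Subgroup (GLn m)) : Prop where
  le_levi : F ≤ leviGroup m
  closed : IsClosed (F : Set (GLn m))
  connected : IsConnected (F : Set (GLn m))
  nontrivial : ∃ x, leviHom m x ∈ F ∧ x.2 ≠ 1

/-- The group `G = F N` generated by `F` and `N`. -/
def grpG {m : ℕ} (F : Subgroup (GLn m)) : Subgroup (GLn m) := F ⊔ nilGroup m

/-- The isotropy group `H = F ∩ SO(n-1)`. -/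
def grpH {m : ℕ} (F : Subgroup (GLn m)) : Subgroup (GLn m) := F ⊓ rotGroup m

/-- The condition on `𝔞_r` : it is a one-dimensional complement to `𝔥₀ + 𝔫` in `(𝔣_r)₀ + 𝔫`,
where the index `0` stands for the centre, and it projects non-trivially to `𝔞` (the projection to
`𝔞` is given by a diagonal entry). In particular it may be any line `𝔞_r` in `𝔣_r` with
`𝔣_r = 𝔥 ⊕ 𝔞_r` and `[𝔥, 𝔞_r] = 0`. -/
structure IsLineAr {m : ℕ} (F : Subgroup (GLn m)) (ar : Submodule ℝ (Mat m)) : Prop where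
  finrank_eq : Module.finrank ℝ ar = 1
  disjoint : ar ⊓ (lieCenter (lieAlg (grpH F)) ⊔ lieN m) = ⊥
  sup_eq : ar ⊔ (lieCenter (lieAlg (grpH F)) ⊔ lieN m) = lieCenter (lieAlg F) ⊔ lieN m
  proj : ∃ X ∈ ar, X (Sum.inr 0) (Sum.inr 0) ≠ 0

/-- `𝔪` is a reductive complement: an `Ad_H`-invariant complement to `𝔥` in `𝔤`. -/
structure IsReductiveComplement {m : ℕ} (F : Subgroup (GLn m)) (p : Submodule ℝ (Mat m)) :
    Prop where
  disjoint : (lieAlg (grpH F)).toSubmodule ⊓ p = ⊥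
  sup_eq : (lieAlg (grpH F)).toSubmodule ⊔ p = (lieAlg (grpG F)).toSubmodule
  ad_invariant : ∀ k ∈ grpH F, ∀ X ∈ p, (k : Mat m) * X * ((k⁻¹ : GLn m) : Mat m) ∈ p

/-- A linear map `f` between subspaces of matrices is `𝔥`-equivariant for the adjoint action. -/
def IsEquivariant {m : ℕ} (h : LieSubalgebra ℝ (Mat m)) {V W : Submodule ℝ (Mat m)}
    (f : V →ₗ[ℝ] W) : Prop :=
  ∀ Z ∈ h, ∀ v v' : V, (v' : Mat m) = ⁅Z, (v : Mat m)⁆ → (f v' : Mat m) = ⁅Z, (f v : Mat m)⁆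

/-- The image under `f` of the subspace `𝔫`. -/
def imageN {m : ℕ} {V W : Submodule ℝ (Mat m)} (f : V →ₗ[ℝ] W) : Submodule ℝ (Mat m) :=
  ((lieN m).comap V.subtype).map (W.subtype ∘ₗ f)

/-- The graph `{s + f s}` of a linear map between subspaces of matrices. -/
def graphOf {m : ℕ} {V W : Submodule ℝ (Mat m)} (f : V →ₗ[ℝ] W) : Submodule ℝ (Mat m) :=
  LinearMap.range (V.subtype + W.subtype ∘ₗ f)

/-- `cov` is the canonical connection of the decomposition `𝔤 = 𝔥 + 𝔪` : it is smooth and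
`G`-invariant, and `∇_B C = -[B, C]_𝔪` at the base point for `B ∈ 𝔪`, `C ∈ 𝔤`. Here elements of
`𝔤` are extended to vector fields on `RH(n)` as in `fundField`, and `D` is `[B, C]_𝔪`. -/
structure IsCanonicalConnection {m : ℕ} (F : Subgroup (GLn m)) (p : Submodule ℝ (Mat m))
    (cov : AffConn m) : Prop where
  smooth : CovariantDerivative.ContMDiffCovariantDerivative cov ∞
  invariant : ∀ g ∈ grpG F, ∀ σ τ : Π u : RH m, Tan u,
    IsSmoothField σ → IsSmoothField τ →
    (∀ u, τ (act g u) = actDeriv g u (σ u)) →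
    ∀ u (v : Tan u), cov τ (act g u) (actDeriv g u v) = actDeriv g u (cov σ u v)
  base : ∀ B ∈ p, ∀ C ∈ lieAlg (grpG F), ∀ D ∈ p, ⁅B, C⁆ - D ∈ lieAlg (grpH F) →
    cov (fundField C) (basePt m) (fundField B (basePt m)) = -fundField D (basePt m)

end

end RHHol

open RHHol

namespace RHHol

noncomputable section

/-! ### Connections on a normed space -/

section VectorSpace

variable {E : Type*} [NormedAddCommGroup E] [NormedSpace ℝ E]

/-! In horospherical coordinates `(x, t)` the group `G` acts by affine maps: `N` translates `x`, and
`diag(k, lam, lam⁻¹)` sends `(x, t)` to `(lam k x, t + log lam)` (`affMap`, `exists_act_eq_affMap`).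
Connections and curvature therefore become computations with Christoffel symbols on a vector space.

The algebraic data have a normal form (`IsAdapted`, `exists_isAdapted`). Modulo `𝔫`, the line `𝔞_r`
is spanned by a central element `A = diag(K', l, -l)` of `𝔣_r`. Adding `φ_r(A)` and rescaling gives
`diag(K, 1, -1)` with `K` skew and commuting with `𝔥`, and `𝔪` consists of the matrices `diag(c K +
Φ(v), c, -c) + v`, where `Φ` is `φ_r` restricted to `𝔫`. Equivariance of `φ_r` gives `[Z, Φ v] = Φ(Z
v)` for `Z ∈ 𝔥`.

Fundamental fields are affine in these coordinates, so the defining equation determines the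
Christoffel symbols at `o`: `Γ(X, Y) = -(X_t (1 + K) Y_x + Φ(X_x) Y_x, 0)`. Transport along `exp(s
diag(K, 1, -1))` replaces `Φ(X_x)` at height `t` by `e^{-t} Φ(exp(-tK) X_x)`. The resulting
connection is smooth and invariant (`IsAdapted.isCanonicalConnection`), and every canonical
connection agrees with it on smooth fields.

Since `K` commutes with every `Φ w`, the curvature at `o` is `X_t Φ((1 + K) Y_x) - Y_t Φ((1 + K)
X_x) + [Φ X_x, Φ Y_x]`. The bracket equals `Φ(Φ(X_x) Y_x)`, so all curvature endomorphisms lie in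
the image of `Φ`, which is a Lie algebra. Conversely `R(∂_t, y) = Φ((1 + K) y)`, and `1 + K` is
invertible because `K` is skew; hence the whole image occurs. Finally `χ_r` is the identity on `𝔫`,
so composing with it leaves the image of `𝔫` unchanged. -/

theorem isSmoothField_iff {X : Π x : E, TangentSpace 𝓘(ℝ, E) x} :
    IsSmoothField X ↔ ContDiff ℝ ∞ (X : E → E) :=
  contMDiff_vectorSpace_iff_contDiff

theorem mdifferentiableAt_field_iff {X : Π x : E, TangentSpace 𝓘(ℝ, E) x} {x : E} :
    MDiffAt (T% X) x ↔ DifferentiableAt ℝ (X : E → E) x := by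
  rw [mdifferentiableAt_section]
  simp only [mdifferentiableAt_iff_differentiableAt]
  refine iff_of_eq (congrArg (fun f : E → E => DifferentiableAt ℝ f x) (funext fun b => ?_))
  simp
  rfl

/-- `∂ σ + Γ(·, σ)` as a one-form. -/
def christoffelDeriv (Γ : E → E →L[ℝ] E →L[ℝ] E) (σ : E → E) (u : E) : E →L[ℝ] E :=
  fderiv ℝ σ u + (Γ u).flip (σ u)

theorem christoffelDeriv_add (Γ : E → E →L[ℝ] E →L[ℝ] E) {σ σ' : E → E} {x : E}
    (hσ : DifferentiableAt ℝ σ x) (hσ' : DifferentiableAt ℝ σ' x) :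
    christoffelDeriv Γ (σ + σ') x = christoffelDeriv Γ σ x + christoffelDeriv Γ σ' x := by
  simp only [christoffelDeriv]
  rw [fderiv_add hσ hσ', Pi.add_apply, map_add]
  abel

theorem christoffelDeriv_smul (Γ : E → E →L[ℝ] E →L[ℝ] E) {g : E → ℝ} {σ : E → E} {x : E}
    (hσ : DifferentiableAt ℝ σ x) (hg : DifferentiableAt ℝ g x) :
    christoffelDeriv Γ (g • σ) x =
      g x • christoffelDeriv Γ σ x + (fderiv ℝ g x).smulRight (σ x) := by
  simp only [christoffelDeriv]
  rw [fderiv_smul hg hσ, Pi.smul_apply', map_smul, smul_add]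
  abel

theorem contDiff_christoffelDeriv {Γ : E → E →L[ℝ] E →L[ℝ] E} (hΓ : ContDiff ℝ ∞ Γ) {σ : E → E}
    (hσ : ContDiff ℝ ∞ σ) : ContDiff ℝ ∞ (christoffelDeriv Γ σ) := by
  have h1 : ContDiff ℝ ∞ (fderiv ℝ σ) := hσ.fderiv_right (by simp)
  have h2 : ContDiff ℝ ∞ fun u => (Γ u).flip :=
    (ContinuousLinearMap.flipₗᵢ ℝ E E E).contDiff.comp hΓ
  exact h1.add (h2.clm_apply hσ)

theorem fderiv_christoffelDeriv_apply {Γ : E → E →L[ℝ] E →L[ℝ] E} (hΓ : ContDiff ℝ ∞ Γ)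
    {Y Z : E → E} (hY : ContDiff ℝ ∞ Y) (hZ : ContDiff ℝ ∞ Z) (p v : E) :
    fderiv ℝ (fun y => christoffelDeriv Γ Z y (Y y)) p v =
        fderiv ℝ (fderiv ℝ Z) p v (Y p) + fderiv ℝ Z p (fderiv ℝ Y p v)
          + (fderiv ℝ Γ p v (Y p) (Z p) + Γ p (fderiv ℝ Y p v) (Z p)
            + Γ p (Y p) (fderiv ℝ Z p v)) := by
  have dY := (hY.differentiable (by simp) p).hasFDerivAt
  have dZ := (hZ.differentiable (by simp) p).hasFDerivAt
  have dΓ := (hΓ.differentiable (by simp) p).hasFDerivAt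
  have dZ' := ((hZ.fderiv_right (m := ∞) (by simp)).differentiable (by simp) p).hasFDerivAt
  have h : (fun y => christoffelDeriv Γ Z y (Y y)) =
      (fun y => fderiv ℝ Z y (Y y)) + fun y => Γ y (Y y) (Z y) := rfl
  rw [h, ((dZ'.clm_apply dY).add ((dΓ.clm_apply dY).clm_apply dZ)).fderiv]
  simp
  abel

/-- Second derivatives of `Z` cancel by symmetry, the terms `Γ(Y, ∂_X Z) + Γ(X, ∂_Y Z)` are
symmetric in `X, Y`, and the bracket term absorbs the derivatives of `X` and `Y`. Only values at `p`
remain. -/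
theorem christoffelDeriv_curvature {Γ : E → E →L[ℝ] E →L[ℝ] E} (hΓ : ContDiff ℝ ∞ Γ)
    {X Y Z : E → E} (hX : ContDiff ℝ ∞ X) (hY : ContDiff ℝ ∞ Y) (hZ : ContDiff ℝ ∞ Z) (p : E) :
    christoffelDeriv Γ (fun y => christoffelDeriv Γ Z y (Y y)) p (X p)
      - christoffelDeriv Γ (fun y => christoffelDeriv Γ Z y (X y)) p (Y p)
      - christoffelDeriv Γ Z p (VectorField.lieBracket ℝ X Y p) =
      fderiv ℝ Γ p (X p) (Y p) (Z p) - fderiv ℝ Γ p (Y p) (X p) (Z p)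
        + Γ p (X p) (Γ p (Y p) (Z p)) - Γ p (Y p) (Γ p (X p) (Z p)) := by
  have hsymm : fderiv ℝ (fderiv ℝ Z) p (Y p) (X p) = fderiv ℝ (fderiv ℝ Z) p (X p) (Y p) :=
    (hZ.contDiffAt.isSymmSndFDerivAt (by simp; norm_cast)) _ _
  have h (σ : E → E) (v : E) :
      christoffelDeriv Γ σ p v = fderiv ℝ σ p v + Γ p v (σ p) := rfl
  rw [h, h (fun y => christoffelDeriv Γ Z y (X y)), h, fderiv_christoffelDeriv_apply hΓ hY hZ,
    fderiv_christoffelDeriv_apply hΓ hX hZ, hsymm, VectorField.lieBracket, h, h]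
  simp only [map_add, map_sub, sub_apply]
  abel

/-- The covariant derivative `∂_X Y + Γ(X, Y)` on a normed space. -/
def ofChristoffel (Γ : E → E →L[ℝ] E →L[ℝ] E) :
    CovariantDerivative 𝓘(ℝ, E) E (TangentSpace 𝓘(ℝ, E) : E → Type _) where
  toFun σ u := show E →L[ℝ] E from christoffelDeriv Γ (E := E) σ u
  isCovariantDerivativeOnUniv :=
    { add := fun {σ σ' x} hσ hσ' _ => christoffelDeriv_add Γ (σ := σ) (σ' := σ')
        (mdifferentiableAt_field_iff.1 hσ) (mdifferentiableAt_field_iff.1 hσ')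
      leibniz := by
        intro σ g x hσ hg _
        have hd : d% g x = fderiv ℝ g x := by
          simp only [mvfderiv, mfderiv_eq_fderiv]
          rfl
        rw [hd]
        exact christoffelDeriv_smul Γ (σ := σ) (mdifferentiableAt_field_iff.1 hσ)
          (mdifferentiableAt_iff_differentiableAt.1 hg) }

theorem contMDiff_ofChristoffel {Γ : E → E →L[ℝ] E →L[ℝ] E} (hΓ : ContDiff ℝ ∞ Γ) :
    CovariantDerivative.ContMDiffCovariantDerivative (ofChristoffel Γ) ∞ := by
  refine ⟨⟨fun {σ} hσ => ?_⟩⟩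
  rw [contMDiffOn_univ] at hσ ⊢
  intro x
  rw [contMDiffAt_hom_bundle]
  refine ⟨contMDiffAt_id, ?_⟩
  have h := (contDiff_christoffelDeriv hΓ (σ := σ)
    (contMDiff_vectorSpace_iff_contDiff.1 hσ)).contMDiff x
  refine h.congr_of_eventuallyEq (Filter.Eventually.of_forall fun y => ?_)
  -- The tangent bundle of a vector space is trivialized by the identity, so the coordinate
  -- expression is the map itself.
  exact inCoordinates_tangent_bundle_core_model_space (I := 𝓘(ℝ, E)) (I' := 𝓘(ℝ, E)) x y x y
    (christoffelDeriv Γ σ y)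

theorem mlieBracket_eq_lieBracket (X Y : Π x : E, TangentSpace 𝓘(ℝ, E) x) (p : E) :
    VectorField.mlieBracket 𝓘(ℝ, E) X Y p = VectorField.lieBracket ℝ (X : E → E) (Y : E → E) p := by
  have h := congrFun (VectorField.mlieBracketWithin_eq_lieBracketWithin (𝕜 := ℝ) (V := X) (W := Y)
    (s := Set.univ)) p
  rw [VectorField.mlieBracketWithin_univ] at h
  exact h.trans (congrFun VectorField.lieBracketWithin_univ p)

theorem curvature_ofChristoffel {Γ : E → E →L[ℝ] E →L[ℝ] E} (hΓ : ContDiff ℝ ∞ Γ)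
    {X Y Z : E → E} (hX : ContDiff ℝ ∞ X) (hY : ContDiff ℝ ∞ Y) (hZ : ContDiff ℝ ∞ Z) (p : E) :
    curvature (I := 𝓘(ℝ, E)) (ofChristoffel Γ) X Y Z p =
      fderiv ℝ Γ p (X p) (Y p) (Z p) - fderiv ℝ Γ p (Y p) (X p) (Z p)
        + Γ p (X p) (Γ p (Y p) (Z p)) - Γ p (Y p) (Γ p (X p) (Z p)) := by
  have h := christoffelDeriv_curvature hΓ hX hY hZ p
  have e : christoffelDeriv Γ Z p (VectorField.mlieBracket 𝓘(ℝ, E) X Y p) =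
      christoffelDeriv Γ Z p (VectorField.lieBracket ℝ X Y p) :=
    congrArg (christoffelDeriv Γ Z p) (mlieBracket_eq_lieBracket X Y p)
  rw [← e] at h
  exact h

/-- The difference of two covariant derivatives is tensorial. -/
theorem sub_apply_eq_of_eq_at [FiniteDimensional ℝ E]
    (c c' : CovariantDerivative 𝓘(ℝ, E) E (TangentSpace 𝓘(ℝ, E) : E → Type _))
    {σ τ : Π x : E, TangentSpace 𝓘(ℝ, E) x} {u : E} (hσ : IsSmoothField σ) (hτ : IsSmoothField τ)
    (h : σ u = τ u) : c σ u - c' σ u = c τ u - c' τ u := by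
  have h1 := IsCovariantDerivativeOn.difference_apply c.isCovariantDerivativeOnUniv
    c'.isCovariantDerivativeOnUniv (x := u) (by trivial) (hσ.mdifferentiable (by simp) u)
  have h2 := IsCovariantDerivativeOn.difference_apply c.isCovariantDerivativeOnUniv
    c'.isCovariantDerivativeOnUniv (x := u) (by trivial) (hτ.mdifferentiable (by simp) u)
  rw [← h1, ← h2, h]

/-- Covariant derivatives that agree on smooth fields have the same curvature. -/
theorem curvature_congr_ofChristoffel {Γ : E → E →L[ℝ] E →L[ℝ] E} (hΓ : ContDiff ℝ ∞ Γ)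
    {c : CovariantDerivative 𝓘(ℝ, E) E (TangentSpace 𝓘(ℝ, E) : E → Type _)}
    (hc : ∀ σ : Π x : E, TangentSpace 𝓘(ℝ, E) x, IsSmoothField σ → c σ = ofChristoffel Γ σ)
    {X Y Z : Π x : E, TangentSpace 𝓘(ℝ, E) x} (hX : IsSmoothField X) (hY : IsSmoothField Y)
    (hZ : IsSmoothField Z) (p : E) :
    curvature c X Y Z p = curvature (ofChristoffel Γ) X Y Z p := by
  -- The curvature differentiates twice, so the inner derivative must again be a smooth field before
  -- `hc` applies to it.
  have h (W : Π x : E, TangentSpace 𝓘(ℝ, E) x) (hW : IsSmoothField W) :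
      IsSmoothField fun y => ofChristoffel Γ Z y (W y) :=
    isSmoothField_iff.2 ((contDiff_christoffelDeriv hΓ (isSmoothField_iff.1 hZ)).clm_apply
      (isSmoothField_iff.1 hW))
  rw [curvature, curvature, hc Z hZ, hc _ (h X hX), hc _ (h Y hY)]

end VectorSpace

/-! ### One-parameter subgroups of closed subgroups -/

section ClosedSubgroup

open Filter Topology NormedSpace

/-- Telescoping estimate. The crude factor `M ^ n` suffices because it is applied with `M = 1 + C /
n`, whose powers stay below `exp C`. -/
theorem norm_pow_sub_pow_le_of_norm_le {A : Type*} [NormedRing A] [NormOneClass A] {a b : A} {M : ℝ} (ha : ‖a‖ ≤ M)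
    (hb : ‖b‖ ≤ M) (hM : 1 ≤ M) (n : ℕ) : ‖a ^ n - b ^ n‖ ≤ n * M ^ n * ‖a - b‖ := by
  induction n with
  | zero => simp
  | succ n ih =>
    have e : a ^ (n + 1) - b ^ (n + 1) = a ^ n * (a - b) + (a ^ n - b ^ n) * b := by
      rw [pow_succ, pow_succ]; noncomm_ring
    have h0 : 0 ≤ M := by linarith
    have h1 : ‖a ^ n * (a - b)‖ ≤ M ^ n * ‖a - b‖ :=
      (norm_mul_le _ _).trans (by gcongr; exact (norm_pow_le a n).trans (by gcongr))
    have h2 : ‖(a ^ n - b ^ n) * b‖ ≤ (n * M ^ n * ‖a - b‖) * M :=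
      (norm_mul_le _ _).trans (by gcongr)
    have h3 : M ^ n * ‖a - b‖ ≤ M ^ n * ‖a - b‖ * M := le_mul_of_one_le_right (by positivity) hM
    rw [e]
    refine (norm_add_le _ _).trans ?_
    push_cast
    rw [pow_succ]
    nlinarith

variable {A : Type*} [NormedRing A] [NormedAlgebra ℝ A]

theorem tendsto_nat_smul_sub_one {f : ℝ → A} {Z : A} (hf : HasDerivAt f Z 0) (h0 : f 0 = 1) :
    Tendsto (fun n : ℕ => (n : ℝ) • (f (n : ℝ)⁻¹ - 1)) atTop (𝓝 Z) := by
  have h := hf.tendsto_slope_zero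
  have h1 : Tendsto (fun n : ℕ => ((n : ℝ))⁻¹) atTop (𝓝[≠] 0) :=
    tendsto_nhdsWithin_iff.2 ⟨tendsto_inv_atTop_nhds_zero_nat,
      (eventually_gt_atTop 0).mono fun n hn => by simp; omega⟩
  simpa [Function.comp_def, h0] using h.comp h1

/-- The generators of the one-parameter subgroups of `G`. -/
def oneParam (G : Subgroup Aˣ) : Set A := {X | ∀ t : ℝ, ∃ g ∈ G, (g : A) = exp (t • X)}

theorem smul_mem_oneParam {G : Subgroup Aˣ} {X : A} (hX : X ∈ oneParam G) (c : ℝ) :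
    c • X ∈ oneParam G := fun t => by
  obtain ⟨g, hg, h⟩ := hX (t * c)
  exact ⟨g, hg, by rw [h, mul_smul]⟩

variable [CompleteSpace A]

theorem hasDerivAt_exp_smul (X : A) : HasDerivAt (fun t : ℝ => exp (t • X)) X 0 := by
  simpa using hasDerivAt_exp_smul_const (𝕂 := ℝ) X 0

/-- If `n (γ n - 1)` converges to `Z`, then `γ n ^ n` converges to `exp Z`. -/
theorem tendsto_pow_exp [NormOneClass A] {γ : ℕ → A} {Z : A}
    (hγ : Tendsto (fun n : ℕ => (n : ℝ) • (γ n - 1)) atTop (𝓝 Z)) :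
    Tendsto (fun n => γ n ^ n) atTop (𝓝 (exp Z)) := by
  set e : ℕ → A := fun n => exp ((n : ℝ)⁻¹ • Z) with he
  have h1 : Tendsto (fun n : ℕ => (n : ℝ) • (e n - 1)) atTop (𝓝 Z) :=
    tendsto_nat_smul_sub_one (hasDerivAt_exp_smul Z) (by simp)
  have hpow : ∀ᶠ n : ℕ in atTop, e n ^ n = exp Z := by
    filter_upwards [eventually_gt_atTop 0] with n hn
    have hn' : (n : ℝ) ≠ 0 := by positivity
    let _ := NormedAlgebra.restrictScalars ℚ ℝ A
    rw [he]
    simp only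
    rw [← NormedSpace.exp_nsmul, ← Nat.cast_smul_eq_nsmul ℝ, smul_smul, mul_inv_cancel₀ hn', one_smul]
  have hsub : Tendsto (fun n : ℕ => ‖(n : ℝ) • (γ n - e n)‖) atTop (𝓝 0) := by
    have := (hγ.sub h1).norm
    simpa [← smul_sub] using this
  -- Any constant larger than `‖Z‖` would do: it eventually bounds `n ‖u n - 1‖` for both sequences
  -- compared below.
  set C : ℝ := ‖Z‖ + 1
  have hC : 0 ≤ C := by positivity
  have bound : ∀ {u : ℕ → A}, Tendsto (fun n : ℕ => (n : ℝ) • (u n - 1)) atTop (𝓝 Z) →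
      ∀ᶠ n : ℕ in atTop, ‖u n‖ ≤ 1 + C / n := by
    intro u hu
    filter_upwards [hu.norm.eventually (gt_mem_nhds (lt_add_one ‖Z‖)), eventually_gt_atTop 0]
      with n hn hn0
    have hn' : (0 : ℝ) < n := by positivity
    have h2 : ‖u n - 1‖ ≤ C / n := by
      rw [le_div_iff₀ hn', mul_comm]
      rw [norm_smul, Real.norm_natCast] at hn
      exact hn.le
    calc ‖u n‖ = ‖1 + (u n - 1)‖ := by simp
      _ ≤ ‖(1 : A)‖ + ‖u n - 1‖ := norm_add_le _ _
      _ ≤ _ := by rw [norm_one]; gcongr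
  have hdiff : Tendsto (fun n => γ n ^ n - e n ^ n) atTop (𝓝 0) := by
    refine squeeze_zero_norm' ?_ (by simpa using hsub.const_mul (Real.exp C))
    filter_upwards [bound hγ, bound h1, eventually_gt_atTop 0] with n hn hn' hn0
    have hn1 : (0 : ℝ) < n := by positivity
    have hM : (1 : ℝ) ≤ 1 + C / n := by
      have : 0 ≤ C / n := by positivity
      linarith
    have hexp : (1 + C / n) ^ n ≤ Real.exp C := by
      calc (1 + C / n) ^ n ≤ (Real.exp (C / n)) ^ n := by
            gcongr
            rw [add_comm]; exact Real.add_one_le_exp _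
        _ = Real.exp C := by rw [← Real.exp_nat_mul]; congr 1; field_simp
    refine (norm_pow_sub_pow_le_of_norm_le hn hn' hM n).trans ?_
    rw [norm_smul, Real.norm_natCast]
    calc (n : ℝ) * (1 + C / n) ^ n * ‖γ n - e n‖ = (1 + C / n) ^ n * (n * ‖γ n - e n‖) := by ring
      _ ≤ _ := by gcongr
  have := hdiff.add_const (exp Z)
  rw [zero_add] at this
  refine this.congr' ?_
  filter_upwards [hpow] with n hn
  rw [hn]; abel

theorem conj_mem_oneParam {G : Subgroup Aˣ} {X : A} (hX : X ∈ oneParam G) {g : Aˣ} (hg : g ∈ G) :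
    g * X * (g⁻¹ : Aˣ) ∈ oneParam G := fun t => by
  let _ := NormedAlgebra.restrictScalars ℚ ℝ A
  obtain ⟨k, hk, h⟩ := hX t
  refine ⟨g * k * g⁻¹, G.mul_mem (G.mul_mem hg hk) (G.inv_mem hg), ?_⟩
  rw [← smul_mul_assoc, ← mul_smul_comm, NormedSpace.exp_units_conj, ← h]
  simp

/-- Lie product formula: `(exp(X/n) exp(Y/n)) ^ n` lies in `G` and tends to `exp(X + Y)`, so
closedness of `G` applies. -/
theorem add_mem_oneParam [NormOneClass A] {G : Subgroup Aˣ} (hG : IsClosed (G : Set Aˣ)) {X Y : A}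
    (hX : X ∈ oneParam G) (hY : Y ∈ oneParam G) : X + Y ∈ oneParam G := by
  have key : ∀ X ∈ oneParam G, ∀ Y ∈ oneParam G, ∃ g ∈ G, (g : A) = exp (X + Y) := by
    intro X hX Y hY
    choose a ha ha' using hX
    choose b hb hb' using hY
    have hd : HasDerivAt (fun t : ℝ => exp (t • X) * exp (t • Y)) (X + Y) 0 := by
      exact ((hasDerivAt_exp_smul X).mul (hasDerivAt_exp_smul Y)).congr_deriv (by simp)
    have h := tendsto_pow_exp (tendsto_nat_smul_sub_one hd (by simp))
    let _ := NormedAlgebra.restrictScalars ℚ ℝ A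
    have hu : IsUnit (exp (X + Y)) := NormedSpace.isUnit_exp _
    obtain ⟨u, hu⟩ := hu
    refine ⟨u, ?_, hu⟩
    refine hG.mem_of_tendsto (b := atTop) (f := fun n : ℕ => (a (n : ℝ)⁻¹ * b (n : ℝ)⁻¹) ^ n) ?_
      (Eventually.of_forall fun n => G.pow_mem (G.mul_mem (ha _) (hb _)) n)
    -- The units carry the topology induced from the algebra, so convergence may be checked there.
    rw [Units.isOpenEmbedding_val.isEmbedding.tendsto_nhds_iff, hu]
    refine h.congr fun n => ?_
    simp [ha', hb']
  intro t
  rw [smul_add]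
  exact key _ (smul_mem_oneParam hX t) _ (smul_mem_oneParam hY t)

/-- The bracket is the derivative at `0` of `exp(tX) Y exp(-tX)`. The difference quotients lie in
the linear subspace of generators, which is closed because the dimension is finite. -/
theorem lie_mem_oneParam [NormOneClass A] [FiniteDimensional ℝ A] {G : Subgroup Aˣ}
    (hG : IsClosed (G : Set Aˣ)) {X Y : A} (hX : X ∈ oneParam G) (hY : Y ∈ oneParam G) :
    ⁅X, Y⁆ ∈ oneParam G := by
  let S : Submodule ℝ A :=
    { carrier := oneParam G
      add_mem' := add_mem_oneParam hG
      zero_mem' := by simpa using smul_mem_oneParam hX 0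
      smul_mem' := fun c _ h => smul_mem_oneParam h c }
  have hd : HasDerivAt (fun t : ℝ => exp (t • X) * Y * exp (t • -X)) ⁅X, Y⁆ 0 := by
    exact (((hasDerivAt_exp_smul X).mul_const Y).mul (hasDerivAt_exp_smul (-X))).congr_deriv
      (by simp [Ring.lie_def, sub_eq_add_neg])
  have hlim := hd.tendsto_slope_zero
  refine (Submodule.closed_of_finiteDimensional S).mem_of_tendsto hlim (Eventually.of_forall ?_)
  intro t
  refine S.smul_mem _ (S.sub_mem ?_ ?_)
  · obtain ⟨g, hg, h⟩ := hX (0 + t)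
    have hinv : ((g⁻¹ : Aˣ) : A) = exp ((0 + t) • -X) := by
      let _ := NormedAlgebra.restrictScalars ℚ ℝ A
      rw [← Units.mul_right_inj g, Units.mul_inv, h, smul_neg,
        ← NormedSpace.exp_add_of_commute (Commute.neg_right (Commute.refl _))]
      simp
    have := conj_mem_oneParam hY hg
    rw [hinv, h] at this
    exact this
  · have : exp ((0 : ℝ) • X) * Y * exp ((0 : ℝ) • -X) = Y := by simp
    rw [this]
    exact hY

end ClosedSubgroup

/-! ### The matrices `diag(K, lam, -lam)` and their exponentials -/

section Matrices

open NormedSpace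

open scoped Matrix.Norms.Operator in
theorem hasDerivAt_exp_apply {n : Type*} [Fintype n] [DecidableEq n] (X : Matrix n n ℝ) (i j : n) :
    HasDerivAt (fun t : ℝ => exp (t • X) i j) (X i j) 0 :=
  (LinearMap.toContinuousLinearMap (Matrix.entryLinearMap ℝ ℝ i j)).hasFDerivAt.comp_hasDerivAt 0
    (hasDerivAt_exp_smul X)

theorem fromBlocks_sub {n₁ n₂ n₃ n₄ : Type*} (A A' : Matrix n₁ n₃ ℝ) (B B' : Matrix n₁ n₄ ℝ)
    (C C' : Matrix n₂ n₃ ℝ) (D D' : Matrix n₂ n₄ ℝ) :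
    Matrix.fromBlocks A B C D - Matrix.fromBlocks A' B' C' D' =
      Matrix.fromBlocks (A - A') (B - B') (C - C') (D - D') := by
  ext (i | i) (j | j) <;> simp

variable {m : ℕ}

/-- The matrix `diag(K, lam, -lam)`. -/
def levi (K : Matrix (Fin m) (Fin m) ℝ) (lam : ℝ) : Mat m :=
  Matrix.fromBlocks K 0 0 !![lam, 0; 0, -lam]

theorem levi_add (K K' : Matrix (Fin m) (Fin m) ℝ) (l l' : ℝ) :
    levi K l + levi K' l' = levi (K + K') (l + l') := by
  rw [levi, levi, levi, Matrix.fromBlocks_add]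
  congr 1
  · simp
  · simp
  · ext i j; fin_cases i <;> fin_cases j <;> simp [add_comm]

theorem smul_levi (c : ℝ) (K : Matrix (Fin m) (Fin m) ℝ) (l : ℝ) :
    c • levi K l = levi (c • K) (c * l) := by
  rw [levi, levi, Matrix.fromBlocks_smul]
  congr 1
  · simp
  · simp
  · ext i j; fin_cases i <;> fin_cases j <;> simp

theorem lie_levi_levi (K K' : Matrix (Fin m) (Fin m) ℝ) (l l' : ℝ) :
    ⁅levi K l, levi K' l'⁆ = levi ⁅K, K'⁆ 0 := by
  rw [Ring.lie_def, Ring.lie_def, levi, levi, levi, Matrix.fromBlocks_multiply,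
    Matrix.fromBlocks_multiply, fromBlocks_sub]
  congr 1
  · simp
  · simp
  · simp
  · ext i j; fin_cases i <;> fin_cases j <;> simp [mul_comm]

/-- Skewness of `K` makes the row of the bracket match minus its column, so that the bracket stays
in `𝔫`. -/
theorem lie_levi_nilMat {K : Matrix (Fin m) (Fin m) ℝ} (hK : Kᵀ = -K) (l : ℝ) (v : Fin m → ℝ) :
    ⁅levi K l, nilMat m v⁆ = nilMat m (K *ᵥ v + l • v) := by
  have hv (j) : ∑ i, v i * K i j = -∑ i, K j i * v i := by
    rw [← Finset.sum_neg_distrib]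
    refine Finset.sum_congr rfl fun i _ => ?_
    have := congrFun (congrFun hK j) i
    simp only [Matrix.transpose_apply, Matrix.neg_apply] at this
    rw [this]; ring
  rw [Ring.lie_def, levi]
  simp only [nilMat, LinearMap.coe_mk, AddHom.coe_mk]
  rw [Matrix.fromBlocks_multiply, Matrix.fromBlocks_multiply, fromBlocks_sub]
  congr 1
  · simp
  · ext i j
    fin_cases j <;> simp [Matrix.mul_apply, Matrix.mulVec, dotProduct, Fin.sum_univ_two]
    ring
  · ext i j
    fin_cases i <;> simp [Matrix.mulVec, Matrix.vecMul, dotProduct, hv]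
    ring
  · simp

theorem lie_nilMat_nilMat (v w : Fin m → ℝ) : ⁅nilMat m v, nilMat m w⁆ = 0 := by
  rw [Ring.lie_def]
  simp only [nilMat, LinearMap.coe_mk, AddHom.coe_mk]
  rw [Matrix.fromBlocks_multiply, Matrix.fromBlocks_multiply, fromBlocks_sub,
    ← Matrix.fromBlocks_zero]
  congr 1
  · ext i j; simp [Matrix.mul_apply, Fin.sum_univ_two]
  · simp
  · simp
  · ext i j
    fin_cases i <;> fin_cases j <;> simp [Matrix.vecMul, dotProduct, mul_comm]

theorem coe_leviHom (x : Matrix.specialOrthogonalGroup (Fin m) ℝ × {r : ℝ // 0 < r}) :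
    (leviHom m x : Mat m) = Matrix.fromBlocks (x.1 : Matrix (Fin m) (Fin m) ℝ) 0 0
        !![(x.2 : ℝ), 0; 0, (x.2 : ℝ)⁻¹] := rfl

theorem coe_inv_specialOrthogonal (k : Matrix.specialOrthogonalGroup (Fin m) ℝ) :
    ((k⁻¹ : Matrix.specialOrthogonalGroup (Fin m) ℝ) : Matrix (Fin m) (Fin m) ℝ) =
      (k : Matrix (Fin m) (Fin m) ℝ)ᵀ := rfl

theorem specialOrthogonal_mul_transpose (k : Matrix.specialOrthogonalGroup (Fin m) ℝ) :
    (k : Matrix (Fin m) (Fin m) ℝ) * (k : Matrix (Fin m) (Fin m) ℝ)ᵀ = 1 := by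
  rw [← coe_inv_specialOrthogonal, ← Submonoid.coe_mul, mul_inv_cancel]
  rfl

theorem specialOrthogonal_transpose_mul (k : Matrix.specialOrthogonalGroup (Fin m) ℝ) :
    (k : Matrix (Fin m) (Fin m) ℝ)ᵀ * (k : Matrix (Fin m) (Fin m) ℝ) = 1 := by
  rw [← coe_inv_specialOrthogonal, ← Submonoid.coe_mul, inv_mul_cancel]
  rfl

theorem leviHom_conj_levi (x : Matrix.specialOrthogonalGroup (Fin m) ℝ × {r : ℝ // 0 < r})
    (K : Matrix (Fin m) (Fin m) ℝ) (l : ℝ) :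
    (leviHom m x : Mat m) * levi K l * ((leviHom m x)⁻¹ : GLn m) =
      levi ((x.1 : Matrix (Fin m) (Fin m) ℝ) * K * (x.1 : Matrix (Fin m) (Fin m) ℝ)ᵀ) l := by
  have hx : (x.2 : ℝ) ≠ 0 := x.2.2.ne'
  rw [← map_inv, coe_leviHom, coe_leviHom, Prod.fst_inv, coe_inv_specialOrthogonal, levi, levi,
    Matrix.fromBlocks_multiply, Matrix.fromBlocks_multiply]
  congr 1
  · simp
  · simp
  · simp
  · ext i j
    fin_cases i <;> fin_cases j <;> simp
    all_goals field_simp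

theorem leviHom_conj_nilMat (x : Matrix.specialOrthogonalGroup (Fin m) ℝ × {r : ℝ // 0 < r})
    (v : Fin m → ℝ) :
    (leviHom m x : Mat m) * nilMat m v * ((leviHom m x)⁻¹ : GLn m) =
      nilMat m ((x.2 : ℝ) • (x.1 : Matrix (Fin m) (Fin m) ℝ) *ᵥ v) := by
  rw [← map_inv, coe_leviHom, coe_leviHom, Prod.fst_inv, coe_inv_specialOrthogonal]
  simp only [nilMat, LinearMap.coe_mk, AddHom.coe_mk]
  rw [Matrix.fromBlocks_multiply, Matrix.fromBlocks_multiply]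
  congr 1
  · simp
  · ext i j
    fin_cases j <;> simp [Matrix.mul_apply, Matrix.mulVec, dotProduct, Fin.sum_univ_two, mul_comm]
  · ext i j
    fin_cases i <;> simp [Matrix.mulVec, Matrix.vecMul, dotProduct, Finset.mul_sum, mul_comm,
      mul_assoc]
  · simp

open scoped Matrix.Norms.Operator in
theorem exp_fromBlocks_diagonal {n₁ n₂ : Type*} [Fintype n₁] [DecidableEq n₁] [Fintype n₂]
    [DecidableEq n₂] (A : Matrix n₁ n₁ ℝ) (D : Matrix n₂ n₂ ℝ) :
    exp (Matrix.fromBlocks A 0 0 D) = Matrix.fromBlocks (exp A) 0 0 (exp D) := by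
  let f : Matrix n₁ n₁ ℝ × Matrix n₂ n₂ ℝ →+* Matrix (n₁ ⊕ n₂) (n₁ ⊕ n₂) ℝ :=
    { toFun := fun x => Matrix.fromBlocks x.1 0 0 x.2
      map_one' := by simp
      map_zero' := by simp
      map_add' := fun x y => by simp [Matrix.fromBlocks_add]
      map_mul' := fun x y => by simp [Matrix.fromBlocks_multiply] }
  have hf : Continuous f :=
    Continuous.matrix_fromBlocks continuous_fst continuous_const continuous_const continuous_snd
  have h := NormedSpace.map_exp f hf (A, D)
  have h1 : (exp (A, D)).1 = exp A := Prod.fst_exp _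
  have h2 : (exp (A, D)).2 = exp D := Prod.snd_exp _
  change Matrix.fromBlocks (exp (A, D)).1 0 0 (exp (A, D)).2 = exp (Matrix.fromBlocks A 0 0 D) at h
  rw [← h, h1, h2]

theorem exp_levi (K : Matrix (Fin m) (Fin m) ℝ) (l : ℝ) :
    exp (levi K l) = Matrix.fromBlocks (exp K) 0 0 !![Real.exp l, 0; 0, (Real.exp l)⁻¹] := by
  have h : (!![l, 0; 0, -l] : Matrix (Fin 2) (Fin 2) ℝ) = Matrix.diagonal ![l, -l] := by
    ext i j; fin_cases i <;> fin_cases j <;> simp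
  rw [levi, exp_fromBlocks_diagonal, h, Matrix.exp_diagonal]
  congr 1
  ext i j
  fin_cases i <;> fin_cases j <;> simp [Pi.coe_exp, Real.exp_eq_exp_ℝ, NormedSpace.exp_neg]

theorem exp_nilMat (v : Fin m → ℝ) :
    exp (nilMat m v) = 1 + nilMat m v + (2 : ℝ)⁻¹ • nilMat m v ^ 2 := by
  have h2 : nilMat m v ^ 2 = Matrix.fromBlocks 0 0 0 !![0, -(v ⬝ᵥ v); 0, 0] := by
    rw [pow_two]
    simp only [nilMat, LinearMap.coe_mk, AddHom.coe_mk]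
    rw [Matrix.fromBlocks_multiply]
    congr 1
    · ext i j; simp [Matrix.mul_apply, Fin.sum_univ_two]
    · simp
    · simp
    · ext i j
      fin_cases i <;> fin_cases j <;> simp [Matrix.vecMul, dotProduct]
  have h3 : nilMat m v ^ 3 = 0 := by
    rw [pow_succ, h2]
    simp only [nilMat, LinearMap.coe_mk, AddHom.coe_mk]
    rw [Matrix.fromBlocks_multiply, ← Matrix.fromBlocks_zero]
    congr 1
    · simp
    · simp
    · ext i j
      fin_cases i <;> simp [Matrix.mul_apply, dotProduct]
    · simp
  have hz : ∀ n ∉ Finset.range 3, ((n.factorial : ℝ)⁻¹) • nilMat m v ^ n = 0 := by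
    intro n hn
    have : 3 ≤ n := by simpa using hn
    rw [← Nat.add_sub_cancel' this, pow_add, h3, zero_mul, smul_zero]
  rw [NormedSpace.exp_eq_tsum ℝ]
  simp only
  rw [tsum_eq_sum hz]
  simp [Finset.sum_range_succ]

/-! ### Lie algebras of matrix groups -/

open scoped Matrix.Norms.Operator in
/-- The Lie algebra of a closed matrix group consists of the generators of its one-parameter
subgroups. -/
theorem mem_lieAlg_iff {G : Subgroup (GLn m)} (hG : IsClosed (G : Set (GLn m))) {X : Mat m} :
    X ∈ lieAlg G ↔ ∀ t : ℝ, ∃ g ∈ G, (g : Mat m) = exp (t • X) := by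
  refine ⟨fun h => ?_, fun h => LieSubalgebra.subset_lieSpan h⟩
  let L : LieSubalgebra ℝ (Mat m) :=
    { carrier := {X | ∀ t : ℝ, ∃ g ∈ G, (g : Mat m) = exp (t • X)}
      add_mem' := fun hX hY => add_mem_oneParam hG hX hY
      zero_mem' := fun t => ⟨1, G.one_mem, by simp⟩
      smul_mem' := fun c _ h => smul_mem_oneParam h c
      lie_mem' := fun hX hY => lie_mem_oneParam hG hX hY }
  exact (LieSubalgebra.lieSpan_le (K := L)).2 (fun X hX => hX) h

/-- The Lie algebra of the matrices `diag(K, lam, -lam)` with `K` skew-symmetric. -/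
def leviAlg (m : ℕ) : LieSubalgebra ℝ (Mat m) where
  carrier := {X | ∃ K l, Kᵀ = -K ∧ X = levi K l}
  add_mem' := by
    rintro _ _ ⟨K, l, hK, rfl⟩ ⟨K', l', hK', rfl⟩
    exact ⟨K + K', l + l', by simp [hK, hK', add_comm], levi_add _ _ _ _⟩
  zero_mem' := ⟨0, 0, by simp, by simpa using (smul_levi 0 (0 : Matrix (Fin m) (Fin m) ℝ) 0)⟩
  smul_mem' := by
    rintro c _ ⟨K, l, hK, rfl⟩
    exact ⟨c • K, c * l, by simp [hK], smul_levi _ _ _⟩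
  lie_mem' := by
    rintro _ _ ⟨K, l, hK, rfl⟩ ⟨K', l', hK', rfl⟩
    exact ⟨⁅K, K'⁆, 0, by simp [Ring.lie_def, hK, hK'], lie_levi_levi _ _ _ _⟩

/-- The Lie algebra of the matrices `diag(K, 0, 0)` with `K` skew-symmetric. -/
def rotAlg (m : ℕ) : LieSubalgebra ℝ (Mat m) where
  carrier := {X | ∃ K, Kᵀ = -K ∧ X = levi K 0}
  add_mem' := by
    rintro _ _ ⟨K, hK, rfl⟩ ⟨K', hK', rfl⟩
    exact ⟨K + K', by simp [hK, hK', add_comm], by simpa using levi_add K K' 0 0⟩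
  zero_mem' := ⟨0, by simp, by simpa using (smul_levi 0 (0 : Matrix (Fin m) (Fin m) ℝ) 0)⟩
  smul_mem' := by
    rintro c _ ⟨K, hK, rfl⟩
    exact ⟨c • K, by simp [hK], by simpa using smul_levi c K 0⟩
  lie_mem' := by
    rintro _ _ ⟨K, hK, rfl⟩ ⟨K', hK', rfl⟩
    exact ⟨⁅K, K'⁆, by simp [Ring.lie_def, hK, hK'], lie_levi_levi _ _ _ _⟩

/-- Differentiate at `t = 0` the relations satisfied by the entries of `exp(tX)`: vanishing entries,
product of the last two diagonal entries equal to `1`, and `k kᵀ = 1`. -/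
theorem mem_leviAlg_of_exp_mem {X : Mat m}
    (h : ∀ t : ℝ, ∃ g ∈ leviGroup m, (g : Mat m) = exp (t • X)) : X ∈ leviAlg m := by
  choose g hg hX using h
  choose x hx using hg
  have hM (t : ℝ) : exp (t • X) = Matrix.fromBlocks ((x t).1 : Matrix (Fin m) (Fin m) ℝ) 0 0
      !![((x t).2 : ℝ), 0; 0, ((x t).2 : ℝ)⁻¹] := by rw [← hX, ← hx, coe_leviHom]
  have hzero : ∀ i j, (∀ t : ℝ, exp (t • X) i j = 0) → X i j = 0 := fun i j h => by
    have h1 := hasDerivAt_exp_apply X i j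
    simp only [h] at h1
    exact h1.unique (hasDerivAt_const _ _)
  have h12 (i j) : X (Sum.inl i) (Sum.inr j) = 0 := hzero _ _ fun t => by simp [hM]
  have h21 (i j) : X (Sum.inr i) (Sum.inl j) = 0 := hzero _ _ fun t => by simp [hM]
  have h01 : X (Sum.inr 0) (Sum.inr 1) = 0 := hzero _ _ fun t => by simp [hM]
  have h10 : X (Sum.inr 1) (Sum.inr 0) = 0 := hzero _ _ fun t => by simp [hM]
  have hd : X (Sum.inr 0) (Sum.inr 0) + X (Sum.inr 1) (Sum.inr 1) = 0 := by
    have h1 := (hasDerivAt_exp_apply X (Sum.inr 0) (Sum.inr 0)).mul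
      (hasDerivAt_exp_apply X (Sum.inr 1) (Sum.inr 1))
    have h2 : ((fun t : ℝ => exp (t • X) (Sum.inr 0) (Sum.inr 0)) *
        fun t : ℝ => exp (t • X) (Sum.inr 1) (Sum.inr 1)) = fun _ => (1 : ℝ) := by
      funext t
      have := (x t).2.2.ne'
      simp [hM, this]
    rw [h2] at h1
    have h3 := h1.unique (hasDerivAt_const _ _)
    simpa using h3
  have hskew (i j) : X (Sum.inl i) (Sum.inl j) + X (Sum.inl j) (Sum.inl i) = 0 := by
    have h1 := HasDerivAt.fun_sum (u := Finset.univ) fun k (_ : k ∈ Finset.univ) =>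
      (hasDerivAt_exp_apply X (Sum.inl i) (Sum.inl k)).mul
      (hasDerivAt_exp_apply X (Sum.inl j) (Sum.inl k))
    have h2 : (fun t : ℝ => ∑ k : Fin m, ((fun t : ℝ => exp (t • X) (Sum.inl i) (Sum.inl k)) *
        fun t : ℝ => exp (t • X) (Sum.inl j) (Sum.inl k)) t) =
          fun _ => (1 : Matrix (Fin m) (Fin m) ℝ) i j := by
      funext t
      rw [← specialOrthogonal_mul_transpose (x t).1]
      simp [hM, Matrix.mul_apply]
    rw [h2] at h1
    have h3 := h1.unique (hasDerivAt_const _ _)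
    simpa [Finset.sum_add_distrib, Matrix.one_apply] using h3
  refine ⟨X.toBlocks₁₁, X (Sum.inr 0) (Sum.inr 0), ?_, ?_⟩
  · ext i j
    simp [Matrix.toBlocks₁₁]
    linarith [hskew i j]
  · rw [levi]
    ext (i | i) (j | j)
    · simp [Matrix.toBlocks₁₁]
    · simp [h12]
    · simp [h21]
    · fin_cases i <;> fin_cases j <;> simp [h01, h10]
      linarith

theorem lieAlg_le_leviAlg {G : Subgroup (GLn m)} (hG : G ≤ leviGroup m) : lieAlg G ≤ leviAlg m := by
  refine LieSubalgebra.lieSpan_le.2 fun X hX => mem_leviAlg_of_exp_mem fun t => ?_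
  obtain ⟨g, hg, h⟩ := hX t
  exact ⟨g, hG hg, h⟩

theorem mem_rotGroup_iff {g : GLn m} :
    g ∈ rotGroup m ↔ ∃ k : Matrix.specialOrthogonalGroup (Fin m) ℝ, leviHom m (k, 1) = g :=
  Iff.rfl

theorem rotGroup_le_leviGroup : rotGroup m ≤ leviGroup m := by
  intro g hg
  obtain ⟨k, hk⟩ := mem_rotGroup_iff.1 hg
  exact ⟨_, hk⟩

theorem lieAlg_le_rotAlg {G : Subgroup (GLn m)} (hG : G ≤ rotGroup m) : lieAlg G ≤ rotAlg m := by
  refine LieSubalgebra.lieSpan_le.2 fun X hX => ?_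
  obtain ⟨K, l, hK, h⟩ := mem_leviAlg_of_exp_mem (X := X) fun t => by
    obtain ⟨g, hg, h⟩ := hX t
    exact ⟨g, rotGroup_le_leviGroup (hG hg), h⟩
  refine ⟨K, hK, ?_⟩
  obtain rfl : l = 0 := by
    have h1 := hasDerivAt_exp_apply X (Sum.inr 0) (Sum.inr 0)
    have h2 : (fun t : ℝ => exp (t • X) (Sum.inr 0) (Sum.inr 0)) = fun _ => (1 : ℝ) := by
      funext t
      obtain ⟨g, hg, h⟩ := hX t
      obtain ⟨k, rfl⟩ := mem_rotGroup_iff.1 (hG hg)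
      rw [← h, coe_leviHom]
      simp
    rw [h2] at h1
    simpa [h, levi] using h1.unique (hasDerivAt_const _ _)
  exact h

theorem lieAlg_mono {G G' : Subgroup (GLn m)} (h : G ≤ G') : lieAlg G ≤ lieAlg G' := by
  refine LieSubalgebra.lieSpan_mono fun X hX t => ?_
  obtain ⟨g, hg, e⟩ := hX t
  exact ⟨g, h hg, e⟩

end Matrices

/-! ### The action in horospherical coordinates -/

section Action

open NormedSpace

variable {m : ℕ}

/-- The affine map `(x, t) ↦ (lam k x + v, t + log lam)`. -/
def affMap (x : Matrix.specialOrthogonalGroup (Fin m) ℝ × {r : ℝ // 0 < r}) (v : Fin m → ℝ)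
    (u : RH m) : RH m :=
  ((x.2 : ℝ) • (x.1 : Matrix (Fin m) (Fin m) ℝ) *ᵥ u.1 + v, u.2 + Real.log x.2)

theorem dotProduct_mulVec_self (k : Matrix.specialOrthogonalGroup (Fin m) ℝ) (v : Fin m → ℝ) :
    ((k : Matrix (Fin m) (Fin m) ℝ) *ᵥ v) ⬝ᵥ ((k : Matrix (Fin m) (Fin m) ℝ) *ᵥ v) = v ⬝ᵥ v := by
  rw [Matrix.dotProduct_mulVec, Matrix.vecMul_mulVec, specialOrthogonal_transpose_mul,
    Matrix.vecMul_one]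

theorem fromBlocks_diagonal_mulVec (K : Matrix (Fin m) (Fin m) ℝ) (a b : ℝ) (y : Idx m → ℝ) :
    Matrix.fromBlocks K 0 0 !![a, 0; 0, b] *ᵥ y =
      Sum.elim (K *ᵥ fun i => y (Sum.inl i)) ![a * y (Sum.inr 0), b * y (Sum.inr 1)] := by
  rw [Matrix.fromBlocks_mulVec]
  funext j
  rcases j with i | j
  · simp [Function.comp_def]
  · fin_cases j <;> simp [dotProduct]

theorem nilMat_mulVec (v : Fin m → ℝ) (y : Idx m → ℝ) : nilMat m v *ᵥ y =
    Sum.elim (fun i => y (Sum.inr 1) * v i) ![-(∑ i, v i * y (Sum.inl i)), 0] := by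
  simp only [nilMat, LinearMap.coe_mk, AddHom.coe_mk]
  rw [Matrix.fromBlocks_mulVec]
  funext j
  rcases j with i | j
  · simp [Matrix.mulVec, dotProduct, mul_comm]
  · fin_cases j <;> simp [dotProduct]

theorem toHyperboloid_inl (u : RH m) :
    (fun i => toHyperboloid u (Sum.inl i)) = Real.exp (-u.2) • u.1 := rfl

theorem leviHom_mulVec_toHyperboloid
    (x : Matrix.specialOrthogonalGroup (Fin m) ℝ × {r : ℝ // 0 < r}) (u : RH m) :
    (leviHom m x : Mat m) *ᵥ toHyperboloid u = toHyperboloid (affMap x 0 u) := by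
  have hx := x.2.2
  have hx' := hx.ne'
  rw [coe_leviHom, fromBlocks_diagonal_mulVec, toHyperboloid_inl, Matrix.mulVec_smul]
  funext j
  rcases j with i | j
  · simp [toHyperboloid, affMap, Real.exp_add, Real.exp_neg, Real.exp_log hx]
    field_simp
  · fin_cases j
    · simp [toHyperboloid, affMap, dotProduct_mulVec_self, Real.exp_add, Real.exp_neg,
        Real.exp_log hx]
      field_simp
    · simp [toHyperboloid, affMap, Real.exp_add, Real.exp_neg, Real.exp_log hx, mul_comm]

theorem exp_nilMat_mulVec_toHyperboloid (v : Fin m → ℝ) (u : RH m) :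
    exp (nilMat m v) *ᵥ toHyperboloid u = toHyperboloid (affMap 1 v u) := by
  rw [exp_nilMat, pow_two, Matrix.add_mulVec, Matrix.add_mulVec, Matrix.one_mulVec,
    Matrix.smul_mulVec, ← Matrix.mulVec_mulVec, nilMat_mulVec, nilMat_mulVec]
  funext j
  rcases j with i | j
  · simp [toHyperboloid, affMap]
    ring
  · fin_cases j
    · have h1 : ∑ i, v i * (Real.exp (-u.2) * u.1 i) = Real.exp (-u.2) * ∑ i, v i * u.1 i := by
        rw [Finset.mul_sum]; exact Finset.sum_congr rfl fun i _ => by ring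
      have h2 : ∑ i, v i * (Real.exp (-u.2) * v i) = Real.exp (-u.2) * ∑ i, v i * v i := by
        rw [Finset.mul_sum]; exact Finset.sum_congr rfl fun i _ => by ring
      have h3 : ∑ i, u.1 i * v i = ∑ i, v i * u.1 i := Finset.sum_congr rfl fun i _ => mul_comm _ _
      simp [toHyperboloid, affMap, dotProduct, add_mul, mul_add, Finset.sum_add_distrib, h1, h2, h3]
      ring
    · simp [toHyperboloid, affMap]

theorem affMap_affMap (x y : Matrix.specialOrthogonalGroup (Fin m) ℝ × {r : ℝ // 0 < r})
    (v w : Fin m → ℝ) (u : RH m) :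
    affMap x v (affMap y w u) =
      affMap (x * y) ((x.2 : ℝ) • (x.1 : Matrix (Fin m) (Fin m) ℝ) *ᵥ w + v) u := by
  refine Prod.ext ?_ ?_
  · simp [affMap, Matrix.mulVec_add, Matrix.mulVec_smul, smul_smul, add_assoc]
  · simp [affMap, Real.log_mul x.2.2.ne' y.2.2.ne']
    ring

theorem affMap_one_zero (u : RH m) : affMap 1 0 u = u := by
  simp [affMap]

/-- The matrices that act through affine maps `affMap x v` with `leviHom m x ∈ F`. -/
def affGroup (F : Subgroup (GLn m)) : Subgroup (GLn m) where
  carrier := {g | ∃ x v, leviHom m x ∈ F ∧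
    ∀ u : RH m, (g : Mat m) *ᵥ toHyperboloid u = toHyperboloid (affMap x v u)}
  mul_mem' := by
    rintro g g' ⟨x, v, hx, h⟩ ⟨x', v', hx', h'⟩
    refine ⟨x * x', (x.2 : ℝ) • (x.1 : Matrix (Fin m) (Fin m) ℝ) *ᵥ v' + v, by rw [map_mul]; exact F.mul_mem hx hx', fun u => ?_⟩
    rw [Units.val_mul, ← Matrix.mulVec_mulVec, h', h, affMap_affMap]
  one_mem' := ⟨1, 0, by rw [map_one]; exact F.one_mem, fun u => by simp [affMap_one_zero]⟩
  inv_mem' := by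
    rintro g ⟨x, v, hx, h⟩
    refine ⟨x⁻¹, -((x⁻¹.2 : ℝ) • ((x⁻¹).1 : Matrix (Fin m) (Fin m) ℝ) *ᵥ v),
      by rw [map_inv]; exact F.inv_mem hx, fun u => ?_⟩
    have hg : ((g⁻¹ : GLn m) : Mat m) * (g : Mat m) = 1 := Units.inv_mul g
    -- Writing `u` as the image of the candidate inverse lets `g⁻¹ g = 1` cancel on the vectors of
    -- the hyperboloid.
    have e : affMap x v (affMap x⁻¹ (-((x⁻¹.2 : ℝ) • ((x⁻¹).1 : Matrix (Fin m) (Fin m) ℝ) *ᵥ v)) u)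
        = u := by
      rw [affMap_affMap, mul_inv_cancel]
      convert affMap_one_zero u
      have h0 : (x.2 : ℝ) * (x.2 : ℝ)⁻¹ = 1 := mul_inv_cancel₀ x.2.2.ne'
      rw [Prod.fst_inv, coe_inv_specialOrthogonal]
      simp [Matrix.mulVec_neg, Matrix.mulVec_smul, smul_smul, h0,
        specialOrthogonal_mul_transpose]
    conv_lhs => rw [← e, ← h, Matrix.mulVec_mulVec, hg, Matrix.one_mulVec]

theorem exists_coe_eq_exp (X : Mat m) : ∃ g : GLn m, (g : Mat m) = exp X :=
  Matrix.isUnit_exp X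

/-- Checking the generators is enough since `affGroup F` is a group. Its condition is phrased with
matrix–vector products because `act` need not be multiplicative on arbitrary matrices. -/
theorem grpG_le_affGroup {F : Subgroup (GLn m)} (hF : F ≤ leviGroup m) : grpG F ≤ affGroup F := by
  refine sup_le (fun g hg => ?_) ((Subgroup.closure_le _).2 ?_)
  · obtain ⟨x, rfl⟩ := hF hg
    exact ⟨x, 0, hg, leviHom_mulVec_toHyperboloid x⟩
  · rintro g ⟨_, ⟨v, rfl⟩, hg⟩
    refine ⟨1, v, by rw [map_one]; exact F.one_mem, fun u => ?_⟩
    rw [hg, exp_nilMat_mulVec_toHyperboloid]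

theorem act_eq_of_mulVec {g : Mat m} {u u' : RH m}
    (h : g *ᵥ toHyperboloid u = toHyperboloid u') : act g u = u' := by
  rw [act, h, ofHyperboloid_toHyperboloid]

theorem exists_act_eq_affMap {F : Subgroup (GLn m)} (hF : F ≤ leviGroup m) {g : GLn m}
    (hg : g ∈ grpG F) : ∃ x v, leviHom m x ∈ F ∧ act (g : Mat m) = affMap x v := by
  obtain ⟨x, v, hx, h⟩ := grpG_le_affGroup hF hg
  exact ⟨x, v, hx, funext fun u => act_eq_of_mulVec (h u)⟩

theorem exists_mem_grpG_act_eq {F : Subgroup (GLn m)}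
    {x : Matrix.specialOrthogonalGroup (Fin m) ℝ × {r : ℝ // 0 < r}} (hx : leviHom m x ∈ F)
    (v : Fin m → ℝ) : ∃ g ∈ grpG F, act (g : Mat m) = affMap x v := by
  obtain ⟨g, hg⟩ := exists_coe_eq_exp (nilMat m v)
  refine ⟨g * leviHom m x, mul_mem (Subgroup.mem_sup_right (Subgroup.subset_closure ⟨_, ⟨v, rfl⟩, hg⟩))
    (Subgroup.mem_sup_left hx), funext fun u => act_eq_of_mulVec ?_⟩
  rw [Units.val_mul, ← Matrix.mulVec_mulVec, leviHom_mulVec_toHyperboloid, hg,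
    exp_nilMat_mulVec_toHyperboloid, affMap_affMap]
  simp

theorem hasDerivAt_exp_mulVec (C : Mat m) (y : Idx m → ℝ) (i : Idx m) :
    HasDerivAt (fun t : ℝ => (exp (t • C) *ᵥ y) i) ((C *ᵥ y) i) 0 :=
  HasDerivAt.fun_sum (u := Finset.univ) fun j _ => (hasDerivAt_exp_apply C i j).mul_const (y j)

/-- The fundamental vector field of `diag(K, l, -l) + v`. -/
theorem fundField_levi_add_nilMat (K : Matrix (Fin m) (Fin m) ℝ) (l : ℝ) (v : Fin m → ℝ)
    (u : RH m) :
    fundField (levi K l + nilMat m v) u = ((K *ᵥ u.1 + l • u.1 + v, l) : RH m) := by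
  set C := levi K l + nilMat m v with hC
  have hq : toHyperboloid u (Sum.inr 1) = Real.exp (-u.2) := by simp [toHyperboloid]
  have hw (i) : toHyperboloid u (Sum.inl i) = Real.exp (-u.2) * u.1 i := by simp [toHyperboloid]
  have hq0 : (exp ((0 : ℝ) • C) *ᵥ toHyperboloid u) (Sum.inr 1) ≠ 0 := by
    simp [hq]
  have hCq : (C *ᵥ toHyperboloid u) (Sum.inr 1) = -l * Real.exp (-u.2) := by
    rw [hC, Matrix.add_mulVec, levi, fromBlocks_diagonal_mulVec, nilMat_mulVec]
    simp [hq]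
  have hCw (i) : (C *ᵥ toHyperboloid u) (Sum.inl i) =
      Real.exp (-u.2) * ((K *ᵥ u.1) i + v i) := by
    rw [hC, Matrix.add_mulVec, levi, fromBlocks_diagonal_mulVec, nilMat_mulVec, toHyperboloid_inl,
      Matrix.mulVec_smul]
    simp [hq, mul_add]
  have h : HasDerivAt (fun t : ℝ => act (exp (t • C)) u) ((K *ᵥ u.1 + l • u.1 + v, l) : RH m) 0 := by
    have h2 := hasDerivAt_exp_mulVec C (toHyperboloid u) (Sum.inr 1)
    refine HasDerivAt.prodMk (hasDerivAt_pi.2 fun i => ?_) ?_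
    · refine ((hasDerivAt_exp_mulVec C (toHyperboloid u) (Sum.inl i)).div h2 hq0).congr_deriv ?_
      simp [hCq, hCw, hq, hw]
      field_simp
      ring
    · refine (h2.log hq0).neg.congr_deriv ?_
      simp [hCq, hq, neg_div]
  exact h.deriv

end Action

/-! ### The isotropy representation -/

section Isotropy

open NormedSpace

variable {m : ℕ}

section
open scoped Matrix.Norms.Operator

theorem hasDerivAt_linearMap_exp {n W : Type*} [Fintype n] [DecidableEq n] [NormedAddCommGroup W]
    [NormedSpace ℝ W] (L : Matrix n n ℝ →ₗ[ℝ] W) (X : Matrix n n ℝ) :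
    HasDerivAt (fun t : ℝ => L (exp (t • X))) (L X) 0 :=
  (LinearMap.toContinuousLinearMap L).hasFDerivAt.comp_hasDerivAt 0 (hasDerivAt_exp_smul X)

theorem contDiff_linearMap_exp {n W : Type*} [Fintype n] [DecidableEq n] [NormedAddCommGroup W]
    [NormedSpace ℝ W] (L : Matrix n n ℝ →ₗ[ℝ] W) (X : Matrix n n ℝ) :
    ContDiff ℝ ∞ (fun t : ℝ => L (exp (t • X))) := by
  refine (LinearMap.toContinuousLinearMap L).contDiff.comp
    (?_ : ContDiff ℝ ∞ fun t : ℝ => exp (t • X))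
  have h : ContDiff ℝ ∞ (exp : Matrix n n ℝ → Matrix n n ℝ) := contDiff_iff_contDiffAt.2 fun x =>
    (NormedSpace.exp_analytic (𝕂 := ℝ) x).contDiffAt
  exact h.comp (contDiff_id.smul contDiff_const)

end

/-- The endomorphism `(x, t) ↦ (M x, 0)`. -/
def blockEnd (m : ℕ) : Matrix (Fin m) (Fin m) ℝ →ₗ[ℝ] (RH m →L[ℝ] RH m) where
  toFun M := (ContinuousLinearMap.inl ℝ (Fin m → ℝ) ℝ).comp
    ((LinearMap.toContinuousLinearMap (Matrix.mulVecLin M)).comp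
      (ContinuousLinearMap.fst ℝ (Fin m → ℝ) ℝ))
  map_add' M M' := by ext <;> simp
  map_smul' c M := by ext <;> simp

theorem blockEnd_apply (M : Matrix (Fin m) (Fin m) ℝ) (u : RH m) :
    blockEnd m M u = (M *ᵥ u.1, 0) := rfl

/-- The matrices `exp(t diag(K, 0, 0))` already act linearly in horospherical coordinates, so each
equals its own differential at `o`. -/
theorem isotropyRep_levi_zero (K : Matrix (Fin m) (Fin m) ℝ) :
    isotropyRep (levi K 0) = ((blockEnd m K : RH m →L[ℝ] RH m) : RH m →ₗ[ℝ] RH m) := by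
  have h (t : ℝ) : act (exp (t • levi K 0)) = fun u => (blockEnd m (exp (t • K)) +
      (ContinuousLinearMap.inr ℝ (Fin m → ℝ) ℝ).comp (ContinuousLinearMap.snd ℝ (Fin m → ℝ) ℝ)) u := by
    funext u
    have hsmul : (fun i => Real.exp (-u.2) * u.1 i) = Real.exp (-u.2) • u.1 := rfl
    rw [smul_levi, exp_levi]
    refine Prod.ext (funext fun i => ?_) ?_
    · simp [act, ofHyperboloid, Matrix.fromBlocks_mulVec, toHyperboloid, blockEnd_apply, Function.comp_def, hsmul, Matrix.mulVec_smul]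
    · simp [act, ofHyperboloid, Matrix.fromBlocks_mulVec, toHyperboloid, blockEnd_apply]
  rw [isotropyRep]
  congr 1
  simp only [h, ContinuousLinearMap.fderiv]
  exact ((hasDerivAt_linearMap_exp (blockEnd m) K).add_const _).deriv

end Isotropy

/-! ### Christoffel symbols depending on one coordinate -/

set_option maxSynthPendingDepth 3

section ExpChristoffel

open NormedSpace

variable {E n : Type*} [NormedAddCommGroup E] [NormedSpace ℝ E] [Fintype n] [DecidableEq n]

/-- The function `u ↦ A + exp(-π u) L(exp(-π u K))`. -/
def expChristoffel (π : E →L[ℝ] ℝ) (A : E →L[ℝ] E →L[ℝ] E)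
    (L : Matrix n n ℝ →ₗ[ℝ] (E →L[ℝ] E →L[ℝ] E)) (K : Matrix n n ℝ) (u : E) :
    E →L[ℝ] E →L[ℝ] E :=
  A + Real.exp (-π u) • L (exp ((-π u) • K))

variable (π : E →L[ℝ] ℝ) (A : E →L[ℝ] E →L[ℝ] E) (L : Matrix n n ℝ →ₗ[ℝ] (E →L[ℝ] E →L[ℝ] E))
  (K : Matrix n n ℝ)

theorem contDiff_expChristoffel : ContDiff ℝ ∞ (expChristoffel π A L K) := by
  have hπ : ContDiff ℝ ∞ fun u => -π u := π.contDiff.neg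
  exact contDiff_const.add (hπ.exp.smul ((contDiff_linearMap_exp L K).comp hπ))

/-- Product rule at a point where both exponentials are trivial: the scalar factor contributes `L
1`, the matrix exponential contributes `L K`. -/
theorem fderiv_expChristoffel_apply {o : E} (ho : π o = 0) (W X Y : E) :
    fderiv ℝ (expChristoffel π A L K) o W X Y = -(π W • (L 1 X Y + L K X Y)) := by
  have hπ : HasFDerivAt (fun u => -π u) (-π) o := π.hasFDerivAt.neg
  have h1 : HasFDerivAt (fun u => L (exp ((-π u) • K)))
      ((-π).smulRight (L K)) o := by
    have h : HasDerivAt (fun t : ℝ => L (exp (t • K))) (L K) (-π o) := by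
      simpa [ho] using hasDerivAt_linearMap_exp L K
    refine (h.hasFDerivAt.comp o hπ).congr_fderiv ?_
    ext; simp
  have h2 : HasFDerivAt (fun u => Real.exp (-π u)) (-π) o := by
    simpa [ho] using hπ.exp
  have h3 : HasFDerivAt (expChristoffel π A L K) _ o := (h2.smul h1).const_add A
  rw [h3.fderiv]
  simp [ho, smul_add]

end ExpChristoffel

/-! ### The canonical connection in horospherical coordinates -/

section Connection

open NormedSpace

variable {m : ℕ}

/-- The linear part `(x, t) ↦ (lam k x, t)` of `affMap`. -/
def affLin (x : Matrix.specialOrthogonalGroup (Fin m) ℝ × {r : ℝ // 0 < r}) : RH m →L[ℝ] RH m :=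
  blockEnd m ((x.2 : ℝ) • (x.1 : Matrix (Fin m) (Fin m) ℝ)) +
    (ContinuousLinearMap.inr ℝ (Fin m → ℝ) ℝ).comp (ContinuousLinearMap.snd ℝ (Fin m → ℝ) ℝ)

theorem affLin_apply (x : Matrix.specialOrthogonalGroup (Fin m) ℝ × {r : ℝ // 0 < r}) (u : RH m) :
    affLin x u = ((x.2 : ℝ) • (x.1 : Matrix (Fin m) (Fin m) ℝ) *ᵥ u.1, u.2) := by
  simp [affLin, blockEnd_apply]

theorem affMap_eq (x : Matrix.specialOrthogonalGroup (Fin m) ℝ × {r : ℝ // 0 < r})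
    (v : Fin m → ℝ) : affMap x v = fun u => affLin x u + (v, Real.log x.2) := by
  funext u
  rw [affLin_apply]
  rfl

theorem affLin_surjective (x : Matrix.specialOrthogonalGroup (Fin m) ℝ × {r : ℝ // 0 < r}) :
    Function.Surjective (affLin x) := by
  intro u
  refine ⟨((x.2 : ℝ)⁻¹ • (x.1 : Matrix (Fin m) (Fin m) ℝ)ᵀ *ᵥ u.1, u.2), ?_⟩
  have hx : (x.2 : ℝ) ≠ 0 := x.2.2.ne'
  rw [affLin_apply]
  simp [Matrix.mulVec_smul, smul_smul, hx, specialOrthogonal_mul_transpose]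

theorem hasFDerivAt_affMap (x : Matrix.specialOrthogonalGroup (Fin m) ℝ × {r : ℝ // 0 < r})
    (v : Fin m → ℝ) (u : RH m) : HasFDerivAt (affMap x v) (affLin x) u := by
  rw [affMap_eq]
  exact (affLin x).hasFDerivAt.add_const _

theorem actDeriv_apply {g : Mat m} {x : Matrix.specialOrthogonalGroup (Fin m) ℝ × {r : ℝ // 0 < r}}
    {v : Fin m → ℝ} (hg : act g = affMap x v) (u w : RH m) :
    (actDeriv g u w : RH m) = affLin x w := by
  have h : (mfderiv 𝓘(ℝ, RH m) 𝓘(ℝ, RH m) (act g) u : RH m →L[ℝ] RH m) = affLin x := by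
    rw [mfderiv_eq_fderiv, hg, (hasFDerivAt_affMap x v u).fderiv]
  exact congrArg (fun f : RH m →L[ℝ] RH m => f w) h

/-- `X ↦ X_t (1 + K)`, up to sign. -/
def christoffelConst (K : Matrix (Fin m) (Fin m) ℝ) : RH m →L[ℝ] RH m →L[ℝ] RH m :=
  -(ContinuousLinearMap.snd ℝ (Fin m → ℝ) ℝ).smulRight (blockEnd m (1 + K))

/-- `X ↦ Φ(M X)`, up to sign. -/
def christoffelLin (Φ : (Fin m → ℝ) →ₗ[ℝ] Matrix (Fin m) (Fin m) ℝ) :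
    Matrix (Fin m) (Fin m) ℝ →ₗ[ℝ] (RH m →L[ℝ] RH m →L[ℝ] RH m) where
  toFun M := (-LinearMap.toContinuousLinearMap
    (blockEnd m ∘ₗ Φ ∘ₗ LinearMap.fst ℝ (Fin m → ℝ) ℝ)).comp (blockEnd m M)
  map_add' M M' := by rw [map_add, ContinuousLinearMap.comp_add]
  map_smul' c M := by rw [map_smul, ContinuousLinearMap.comp_smul]; rfl

theorem christoffelLin_apply (Φ : (Fin m → ℝ) →ₗ[ℝ] Matrix (Fin m) (Fin m) ℝ)
    (M : Matrix (Fin m) (Fin m) ℝ) (X Y : RH m) :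
    christoffelLin Φ M X Y = -blockEnd m (Φ (M *ᵥ X.1)) Y := rfl

/-- The Christoffel symbols of the canonical connection. -/
def christoffel (K : Matrix (Fin m) (Fin m) ℝ)
    (Φ : (Fin m → ℝ) →ₗ[ℝ] Matrix (Fin m) (Fin m) ℝ) : RH m → RH m →L[ℝ] RH m →L[ℝ] RH m :=
  expChristoffel (ContinuousLinearMap.snd ℝ (Fin m → ℝ) ℝ) (christoffelConst K)
    (christoffelLin Φ) K

variable {K : Matrix (Fin m) (Fin m) ℝ} {Φ : (Fin m → ℝ) →ₗ[ℝ] Matrix (Fin m) (Fin m) ℝ}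

theorem christoffel_apply (u X Y : RH m) :
    christoffel K Φ u X Y = (-(X.2 • (Y.1 + K *ᵥ Y.1) +
      Real.exp (-u.2) • Φ (exp ((-u.2) • K) *ᵥ X.1) *ᵥ Y.1), 0) := by
  simp only [christoffel, expChristoffel, christoffelConst, add_apply, smul_apply, neg_apply,
    christoffelLin_apply, ContinuousLinearMap.smulRight_apply, blockEnd_apply]
  refine Prod.ext ?_ ?_
  · simp [Matrix.add_mulVec]
    abel
  · simp

theorem contDiff_christoffel : ContDiff ℝ ∞ (christoffel K Φ) :=
  contDiff_expChristoffel _ _ _ _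

theorem fderiv_christoffel_basePt (W X Y : RH m) :
    fderiv ℝ (christoffel K Φ) (basePt m) W X Y = blockEnd m (W.2 • Φ (X.1 + K *ᵥ X.1)) Y := by
  refine (fderiv_expChristoffel_apply _ _ _ _ (o := basePt m) (by simp [basePt]) W X Y).trans ?_
  rw [christoffelLin_apply, christoffelLin_apply]
  simp [map_add, blockEnd_apply, add_comm]

/-- The curvature of the canonical connection at the base point, as a matrix. -/
def curvMat (K : Matrix (Fin m) (Fin m) ℝ) (Φ : (Fin m → ℝ) →ₗ[ℝ] Matrix (Fin m) (Fin m) ℝ)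
    (X Y : RH m) : Matrix (Fin m) (Fin m) ℝ :=
  X.2 • Φ (Y.1 + K *ᵥ Y.1) - Y.2 • Φ (X.1 + K *ᵥ X.1) + (Φ X.1 * Φ Y.1 - Φ Y.1 * Φ X.1)

/-- The part `X_t (1 + K)` of the Christoffel symbol commutes with itself and with every `Φ w`, so
the quadratic terms reduce to `[Φ X_x, Φ Y_x]`. -/
theorem curvature_christoffel_basePt (hcomm : ∀ w, K * Φ w = Φ w * K) {X Y Z : RH m → RH m}
    (hX : ContDiff ℝ ∞ X) (hY : ContDiff ℝ ∞ Y) (hZ : ContDiff ℝ ∞ Z) :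
    curvature (I := 𝓘(ℝ, RH m)) (ofChristoffel (christoffel K Φ)) X Y Z (basePt m) =
      blockEnd m (curvMat K Φ (X (basePt m)) (Y (basePt m))) (Z (basePt m)) := by
  refine (curvature_ofChristoffel contDiff_christoffel hX hY hZ (basePt m)).trans ?_
  rw [fderiv_christoffel_basePt, fderiv_christoffel_basePt]
  simp only [christoffel_apply, blockEnd_apply]
  refine Prod.ext ?_ ?_
  · have h (w z) : K *ᵥ Φ w *ᵥ z = Φ w *ᵥ K *ᵥ z := by
      rw [Matrix.mulVec_mulVec, hcomm, Matrix.mulVec_mulVec]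
    simp [basePt, curvMat, Matrix.add_mulVec, Matrix.sub_mulVec, Matrix.smul_mulVec,
      Matrix.mulVec_add, Matrix.mulVec_neg, Matrix.mulVec_smul, h, ← Matrix.mulVec_mulVec]
    module
  · simp

/-- The factor `e^{-t}` in the Christoffel symbol is there to absorb the dilation: `e^{-(t + log
lam)} lam = e^{-t}`. The twist `exp(-tK)` does the same for rotations through `hΦ`. -/
theorem christoffel_affMap {x : Matrix.specialOrthogonalGroup (Fin m) ℝ × {r : ℝ // 0 < r}}
    (hK : K * (x.1 : Matrix (Fin m) (Fin m) ℝ) = (x.1 : Matrix (Fin m) (Fin m) ℝ) * K)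
    (hΦ : ∀ t w, Φ (exp ((-(t + Real.log x.2)) • K) *ᵥ (x.1 : Matrix (Fin m) (Fin m) ℝ) *ᵥ w) *
      (x.1 : Matrix (Fin m) (Fin m) ℝ) = (x.1 : Matrix (Fin m) (Fin m) ℝ) * Φ (exp ((-t) • K) *ᵥ w))
    (v : Fin m → ℝ) (u X Y : RH m) :
    christoffel K Φ (affMap x v u) (affLin x X) (affLin x Y) =
      affLin x (christoffel K Φ u X Y) := by
  have hx : (x.2 : ℝ) ≠ 0 := x.2.2.ne'
  have hK' (y) : K *ᵥ (x.1 : Matrix (Fin m) (Fin m) ℝ) *ᵥ y =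
      (x.1 : Matrix (Fin m) (Fin m) ℝ) *ᵥ K *ᵥ y := by
    rw [Matrix.mulVec_mulVec, hK, Matrix.mulVec_mulVec]
  have hΦ' (y w) : Φ (exp ((-(u.2 + Real.log x.2)) • K) *ᵥ
      (x.1 : Matrix (Fin m) (Fin m) ℝ) *ᵥ w) *ᵥ (x.1 : Matrix (Fin m) (Fin m) ℝ) *ᵥ y =
      (x.1 : Matrix (Fin m) (Fin m) ℝ) *ᵥ Φ (exp ((-u.2) • K) *ᵥ w) *ᵥ y := by
    rw [Matrix.mulVec_mulVec, hΦ, Matrix.mulVec_mulVec]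
  have he : Real.exp (-(u.2 + Real.log x.2)) = Real.exp (-u.2) * (x.2 : ℝ)⁻¹ := by
    rw [neg_add, Real.exp_add, Real.exp_neg (Real.log _), Real.exp_log x.2.2]
  simp only [christoffel_apply, affLin_apply, affMap, he, Matrix.mulVec_smul, hK', map_smul,
    Matrix.smul_mulVec, hΦ', smul_smul]
  refine Prod.ext ?_ rfl
  simp only [Matrix.mulVec_neg, Matrix.mulVec_add, Matrix.mulVec_smul]
  simp only [smul_add, smul_neg, smul_smul, mul_comm]
  congr 3
  field_simp

/-- An affine map has no second derivative, so Christoffel symbols transform here as a tensor, and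
invariance of the connection follows from their pointwise equivariance. -/
theorem ofChristoffel_invariant {g : Mat m}
    {x : Matrix.specialOrthogonalGroup (Fin m) ℝ × {r : ℝ // 0 < r}} {v : Fin m → ℝ}
    (hg : act g = affMap x v) {Γ : RH m → RH m →L[ℝ] RH m →L[ℝ] RH m}
    (hΓ : ∀ u X Y, Γ (affMap x v u) (affLin x X) (affLin x Y) = affLin x (Γ u X Y))
    {σ τ : Π u : RH m, Tan u} (hσ : IsSmoothField σ) (hτ : IsSmoothField τ)
    (h : ∀ u, τ (act g u) = actDeriv g u (σ u)) (u : RH m) (w : Tan u) :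
    ofChristoffel Γ τ (act g u) (actDeriv g u w) = actDeriv g u (ofChristoffel Γ σ u w) := by
  have hσ' : ContDiff ℝ ∞ (σ : RH m → RH m) := isSmoothField_iff.1 hσ
  have hτ' : ContDiff ℝ ∞ (τ : RH m → RH m) := isSmoothField_iff.1 hτ
  have h' (u : RH m) : (τ : RH m → RH m) (affMap x v u) = affLin x ((σ : RH m → RH m) u) := by
    have h1 := (h u).trans (actDeriv_apply hg u (σ u))
    rw [hg] at h1
    exact h1
  have hd : (fderiv ℝ (τ : RH m → RH m) (affMap x v u)).comp (affLin x) =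
      (affLin x).comp (fderiv ℝ (σ : RH m → RH m) u) := by
    have h1 := ((hτ'.differentiable (by simp) (affMap x v u)).hasFDerivAt).comp u
      (hasFDerivAt_affMap x v u)
    have h2 := (affLin x).hasFDerivAt.comp u (hσ'.differentiable (by simp) u).hasFDerivAt
    have e : (τ : RH m → RH m) ∘ affMap x v = affLin x ∘ (σ : RH m → RH m) := funext h'
    rw [e] at h1
    exact h1.unique h2
  have key : christoffelDeriv Γ (τ : RH m → RH m) (affMap x v u) (affLin x w) =
      affLin x (christoffelDeriv Γ (σ : RH m → RH m) u w) := by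
    have h3 := congrArg (fun f : RH m →L[ℝ] RH m => f w) hd
    have h4 : Γ (affMap x v u) (affLin x w) ((τ : RH m → RH m) (affMap x v u)) =
        affLin x (Γ u w (σ u)) := (congrArg _ (h' u)).trans (hΓ u w (σ u))
    exact (congrArg₂ (· + ·) h3 h4).trans
      (map_add (affLin x) (fderiv ℝ (σ : RH m → RH m) u w) (Γ u w (σ u))).symm
  have e1 := actDeriv_apply hg u w
  have e2 := actDeriv_apply hg u (christoffelDeriv Γ (σ : RH m → RH m) u w)
  rw [← e1, ← e2, ← hg] at key
  exact key

end Connection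

/-! ### Reductive decompositions in normal form and their canonical connections -/

section Adapted

open NormedSpace

variable {m : ℕ}

theorem levi_add_nilMat_inj {K K' : Matrix (Fin m) (Fin m) ℝ} {l l' : ℝ} {v v' : Fin m → ℝ}
    (h : levi K l + nilMat m v = levi K' l' + nilMat m v') : K = K' ∧ l = l' ∧ v = v' := by
  refine ⟨?_, ?_, ?_⟩
  · ext i j
    simpa [levi, nilMat] using congrFun (congrFun h (Sum.inl i)) (Sum.inl j)
  · simpa [levi, nilMat] using congrFun (congrFun h (Sum.inr 0)) (Sum.inr 0)
  · ext i
    simpa [levi, nilMat] using congrFun (congrFun h (Sum.inl i)) (Sum.inr 1)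

theorem lie_levi_add_nilMat {K K' : Matrix (Fin m) (Fin m) ℝ} (hK : Kᵀ = -K) (hK' : K'ᵀ = -K')
    (l l' : ℝ) (v v' : Fin m → ℝ) :
    ⁅levi K l + nilMat m v, levi K' l' + nilMat m v'⁆ =
      levi ⁅K, K'⁆ 0 + nilMat m ((K *ᵥ v' + l • v') - (K' *ᵥ v + l' • v)) := by
  rw [add_lie, lie_add, lie_add, lie_levi_levi, lie_levi_nilMat hK, lie_nilMat_nilMat,
    ← lie_skew (nilMat m v), lie_levi_nilMat hK', map_sub]
  abel

/-- `𝔤 = 𝔥 + 𝔪` in normal form: `𝔪` consists of the matrices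
`diag(c K + Φ(v), c, -c) + v`, where `diag(K, 1, -1)` is fixed by `Ad_H`. -/
structure IsAdapted (F : Subgroup (GLn m)) (p : Submodule ℝ (Mat m))
    (K : Matrix (Fin m) (Fin m) ℝ) (Φ : (Fin m → ℝ) →ₗ[ℝ] Matrix (Fin m) (Fin m) ℝ) : Prop where
  skew : Kᵀ = -K
  skew_map : ∀ w, (Φ w)ᵀ = -Φ w
  commute : ∀ w, K * Φ w = Φ w * K
  mem_iff : ∀ X, X ∈ p ↔ ∃ (c : ℝ) (v : Fin m → ℝ), X = levi (c • K + Φ v) c + nilMat m v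
  map_mem : ∀ w, levi (Φ w) 0 ∈ lieAlg (grpH F)
  map_mulVec : ∀ Z, levi Z 0 ∈ lieAlg (grpH F) → ∀ v, Φ (Z *ᵥ v) = Z * Φ v - Φ v * Z
  commute_of_mem : ∀ k : Matrix.specialOrthogonalGroup (Fin m) ℝ, leviHom m (k, 1) ∈ F →
    (k : Matrix (Fin m) (Fin m) ℝ) * K = K * (k : Matrix (Fin m) (Fin m) ℝ)
  map_mulVec_of_mem : ∀ k : Matrix.specialOrthogonalGroup (Fin m) ℝ, leviHom m (k, 1) ∈ F →
    ∀ v, Φ ((k : Matrix (Fin m) (Fin m) ℝ) *ᵥ v) * (k : Matrix (Fin m) (Fin m) ℝ) =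
      (k : Matrix (Fin m) (Fin m) ℝ) * Φ v
  exp_mem : ∀ t : ℝ, ∃ g ∈ F, (g : Mat m) = exp (t • levi K 1)
  exists_of_mem : ∀ X ∈ lieAlg (grpG F), ∃ (c : ℝ) (Z : Matrix (Fin m) (Fin m) ℝ) (v : Fin m → ℝ),
    levi Z 0 ∈ lieAlg (grpH F) ∧ X = levi (c • K + Z) c + nilMat m v
  mem_of_mem : ∀ X ∈ p, X ∈ lieAlg (grpG F)

theorem exists_of_mem_lieAlg_grpH {F : Subgroup (GLn m)} {X : Mat m} (hX : X ∈ lieAlg (grpH F)) :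
    ∃ Z, Zᵀ = -Z ∧ X = levi Z 0 :=
  lieAlg_le_rotAlg inf_le_right hX

theorem levi_injective {K K' : Matrix (Fin m) (Fin m) ℝ} {l l' : ℝ} (h : levi K l = levi K' l') :
    K = K' ∧ l = l' := by
  have := levi_add_nilMat_inj (v := 0) (v' := 0) (congrArg (· + nilMat m 0) h)
  exact ⟨this.1, this.2.1⟩

theorem skew_of_mem {F : Subgroup (GLn m)} {Z : Matrix (Fin m) (Fin m) ℝ}
    (hZ : levi Z 0 ∈ lieAlg (grpH F)) : Zᵀ = -Z := by
  obtain ⟨Z', hZ', h⟩ := exists_of_mem_lieAlg_grpH hZ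
  rw [(levi_injective h).1, hZ']

variable {F : Subgroup (GLn m)} {p : Submodule ℝ (Mat m)} {K : Matrix (Fin m) (Fin m) ℝ}
  {Φ : (Fin m → ℝ) →ₗ[ℝ] Matrix (Fin m) (Fin m) ℝ}

namespace IsAdapted

/-- `F` contains `diag(exp(sK), e^s, e^{-s})`. -/
theorem exists_exp_mem (h : IsAdapted F p K Φ) (hF : F ≤ leviGroup m) (s : ℝ) :
    ∃ x, leviHom m x ∈ F ∧ (x.1 : Matrix (Fin m) (Fin m) ℝ) = exp (s • K) ∧
      (x.2 : ℝ) = Real.exp s := by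
  obtain ⟨g, hg, e⟩ := h.exp_mem s
  obtain ⟨x, rfl⟩ := hF hg
  refine ⟨x, hg, ?_⟩
  rw [smul_levi, exp_levi, coe_leviHom, Matrix.fromBlocks_inj] at e
  refine ⟨e.1, ?_⟩
  simpa using congrFun (congrFun e.2.2.2 0) 0

/-- Dividing by the element of the one-parameter group of `diag(K, 1, -1)` with the same dilation
factor leaves a rotation in `F`. Invariance thus only involves `H` and that one-parameter group. -/
theorem exists_eq_mul (h : IsAdapted F p K Φ) (hF : F ≤ leviGroup m)
    {x : Matrix.specialOrthogonalGroup (Fin m) ℝ × {r : ℝ // 0 < r}} (hx : leviHom m x ∈ F) :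
    ∃ k : Matrix.specialOrthogonalGroup (Fin m) ℝ, leviHom m (k, 1) ∈ F ∧
      (x.1 : Matrix (Fin m) (Fin m) ℝ) =
        (k : Matrix (Fin m) (Fin m) ℝ) * exp (Real.log x.2 • K) := by
  obtain ⟨y, hy, hy1, hy2⟩ := h.exists_exp_mem hF (Real.log x.2)
  have h2 : x.2 = y.2 := Subtype.ext (by rw [hy2, Real.exp_log x.2.2])
  refine ⟨x.1 * y.1⁻¹, ?_, ?_⟩
  · have : leviHom m (x * y⁻¹) ∈ F := by
      rw [map_mul, map_inv]; exact F.mul_mem hx (F.inv_mem hy)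
    convert this using 2
    refine Prod.ext rfl ?_
    simp [h2]
  · rw [← hy1, ← Submonoid.coe_mul, inv_mul_cancel_right]

theorem christoffel_affMap (h : IsAdapted F p K Φ) (hF : F ≤ leviGroup m)
    {x : Matrix.specialOrthogonalGroup (Fin m) ℝ × {r : ℝ // 0 < r}} (hx : leviHom m x ∈ F)
    (v : Fin m → ℝ) (u X Y : RH m) :
    christoffel K Φ (affMap x v u) (affLin x X) (affLin x Y) =
      affLin x (christoffel K Φ u X Y) := by
  obtain ⟨k, hk, e⟩ := h.exists_eq_mul hF hx
  have hKexp (s : ℝ) : Commute K (exp (s • K)) :=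
    ((Commute.refl K).smul_right s).exp_right
  have hΦexp (w) (s : ℝ) : Commute (Φ w) (exp (s • K)) :=
    (Commute.smul_right (h.commute w).symm s).exp_right
  have hkexp (s : ℝ) : Commute (k : Matrix (Fin m) (Fin m) ℝ) (exp (s • K)) :=
    (Commute.smul_right (h.commute_of_mem k hk) s).exp_right
  refine RHHol.christoffel_affMap ?_ (fun t w => ?_) v u X Y
  · rw [e, ← mul_assoc, ← h.commute_of_mem k hk, mul_assoc, (hKexp _).eq, mul_assoc]
  · have e1 : exp ((-(t + Real.log x.2)) • K) *ᵥ (x.1 : Matrix (Fin m) (Fin m) ℝ) *ᵥ w =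
        (k : Matrix (Fin m) (Fin m) ℝ) *ᵥ exp ((-t) • K) *ᵥ w := by
      rw [e, Matrix.mulVec_mulVec, Matrix.mulVec_mulVec, ← mul_assoc, ← (hkexp _).eq, mul_assoc,
        ← Matrix.exp_add_of_commute _ _ (((Commute.refl K).smul_right _).smul_left _), ← add_smul]
      congr 4
      ring
    rw [e1, e, ← mul_assoc, h.map_mulVec_of_mem k hk, mul_assoc, (hΦexp _ _).eq, mul_assoc]

theorem fundField_apply_basePt (C : Matrix (Fin m) (Fin m) ℝ) (l : ℝ) (v : Fin m → ℝ) :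
    fundField (levi C l + nilMat m v) (basePt m) = ((v, l) : RH m) := by
  rw [fundField_levi_add_nilMat]
  simp [basePt]
  rfl

/-- Brackets have no `𝔞`-component, which forces `d = 0`. Subtracting an element of `𝔥` does not
affect the `𝔫`-component, so `y` can be read off. -/
theorem lie_decomposition (h : IsAdapted F p K Φ) {a c d : ℝ} {w v y : Fin m → ℝ}
    {Z : Matrix (Fin m) (Fin m) ℝ} (hZ : levi Z 0 ∈ lieAlg (grpH F))
    (hD : ⁅levi (a • K + Φ w) a + nilMat m w, levi (c • K + Z) c + nilMat m v⁆ -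
      (levi (d • K + Φ y) d + nilMat m y) ∈ lieAlg (grpH F)) :
    d = 0 ∧ y = ((a • K + Φ w) *ᵥ v + a • v) - ((c • K + Z) *ᵥ w + c • w) := by
  have hZ' := skew_of_mem hZ
  obtain ⟨T, -, hT⟩ := exists_of_mem_lieAlg_grpH hD
  rw [lie_levi_add_nilMat (by simp [h.skew, h.skew_map]; abel) (by simp [h.skew, hZ']; abel),
    sub_eq_iff_eq_add] at hT
  have e : levi T 0 + (levi (d • K + Φ y) d + nilMat m y) =
      levi (T + (d • K + Φ y)) (0 + d) + nilMat m y := by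
    rw [← add_assoc, levi_add]
  rw [e] at hT
  obtain ⟨-, h1, h2⟩ := levi_add_nilMat_inj hT
  exact ⟨by linarith, h2.symm⟩

theorem isCanonicalConnection (h : IsAdapted F p K Φ) (hF : F ≤ leviGroup m) :
    IsCanonicalConnection F p (ofChristoffel (christoffel K Φ)) where
  smooth := contMDiff_ofChristoffel contDiff_christoffel
  invariant := by
    intro g hg σ τ hσ hτ hστ u w
    obtain ⟨x, v, hx, e⟩ := exists_act_eq_affMap hF hg
    exact ofChristoffel_invariant e (h.christoffel_affMap hF hx v) hσ hτ hστ u w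
  base := by
    intro B hB C hC D hD hBC
    obtain ⟨a, w, rfl⟩ := (h.mem_iff B).1 hB
    obtain ⟨c, Z, v, hZ, rfl⟩ := h.exists_of_mem C hC
    obtain ⟨d, y, rfl⟩ := (h.mem_iff D).1 hD
    obtain ⟨rfl, hy⟩ := h.lie_decomposition hZ hBC
    -- The fundamental field is affine, so its derivative is its linear part. Together with the
    -- Christoffel term this gives exactly minus the `𝔫`-component of the bracket.
    have hC' : (fundField (levi (c • K + Z) c + nilMat m v) : RH m → RH m) =
        fun u => (blockEnd m (c • K + Z + c • 1) u + (v, c) : RH m) := by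
      funext u
      refine (fundField_levi_add_nilMat _ _ _ u).trans ?_
      refine Prod.ext ?_ ?_
      · simp [blockEnd_apply, Matrix.add_mulVec, Matrix.smul_mulVec]
      · simp [blockEnd_apply]
    have hd : fderiv ℝ (fundField (levi (c • K + Z) c + nilMat m v) : RH m → RH m) (basePt m) =
        blockEnd m (c • K + Z + c • 1) := by
      rw [hC']
      exact ((blockEnd m (c • K + Z + c • 1)).hasFDerivAt.add_const _).fderiv
    rw [fundField_apply_basePt, fundField_apply_basePt]
    change (fderiv ℝ (fundField (levi (c • K + Z) c + nilMat m v) : RH m → RH m) (basePt m)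
      ((w, a) : RH m) + christoffel K Φ (basePt m) ((w, a) : RH m)
        (fundField (levi (c • K + Z) c + nilMat m v) (basePt m)) : RH m) = -((y, 0) : RH m)
    rw [hd, fundField_apply_basePt, christoffel_apply, blockEnd_apply, hy]
    refine Prod.ext ?_ ?_
    · simp [basePt, Matrix.add_mulVec, Matrix.smul_mulVec]
      abel
    · simp

theorem isSmoothField_fundField (C : Matrix (Fin m) (Fin m) ℝ) (l : ℝ) (v : Fin m → ℝ) :
    IsSmoothField (fundField (levi C l + nilMat m v)) := by
  rw [isSmoothField_iff]
  have e : (fundField (levi C l + nilMat m v) : RH m → RH m) =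
      fun u => (blockEnd m (C + l • 1) u + (v, l) : RH m) := by
    funext u
    refine (fundField_levi_add_nilMat _ _ _ u).trans ?_
    refine Prod.ext ?_ ?_
    · simp [blockEnd_apply]
    · simp [blockEnd_apply]
  rw [e]
  exact (blockEnd m (C + l • 1)).contDiff.add contDiff_const

theorem isSmoothField_const (y : RH m) :
    IsSmoothField (I := 𝓘(ℝ, RH m)) (fun u : RH m => (y : TangentSpace 𝓘(ℝ, RH m) u)) :=
  isSmoothField_iff.2 contDiff_const

theorem exists_canonical_lie (h : IsAdapted F p K Φ) {B C : Mat m} (hB : B ∈ p) (hC : C ∈ p) :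
    ∃ D ∈ p, ⁅B, C⁆ - D ∈ lieAlg (grpH F) := by
  obtain ⟨c, Z, v, hZ, e⟩ := h.exists_of_mem _
    ((lieAlg (grpG F)).lie_mem (h.mem_of_mem B hB) (h.mem_of_mem C hC))
  refine ⟨_, (h.mem_iff _).2 ⟨c, v, rfl⟩, ?_⟩
  have e2 : ⁅B, C⁆ - (levi (c • K + Φ v) c + nilMat m v) = levi Z 0 - levi (Φ v) 0 := by
    have e3 : levi (c • K + Z) c = levi (c • K) c + levi Z 0 := by rw [levi_add, add_zero]
    have e4 : levi (c • K + Φ v) c = levi (c • K) c + levi (Φ v) 0 := by rw [levi_add, add_zero]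
    rw [e, e3, e4]
    abel
  rw [e2]
  exact sub_mem hZ (h.map_mem v)

/-- Two canonical connections agree on smooth fields. -/
theorem canonicalConnection_unique (h : IsAdapted F p K Φ) (hF : F ≤ leviGroup m)
    {cov cov' : AffConn m} (hc : IsCanonicalConnection F p cov)
    (hc' : IsCanonicalConnection F p cov') {σ : Π u : RH m, Tan u} (hσ : IsSmoothField σ) :
    cov σ = cov' σ := by
  -- At `o` the defining equation fixes both connections on fundamental fields of `𝔪`, and these
  -- take every tangent value. As the difference of the connections is tensorial, constant fields
  -- may replace them.
  have base (X Y : RH m) : cov (fun u => (Y : TangentSpace 𝓘(ℝ, RH m) u)) (basePt m) X =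
      cov' (fun u => (Y : TangentSpace 𝓘(ℝ, RH m) u)) (basePt m) X := by
    have hB := (h.mem_iff (levi (X.2 • K + Φ X.1) X.2 + nilMat m X.1)).2 ⟨_, _, rfl⟩
    have hC := (h.mem_iff (levi (Y.2 • K + Φ Y.1) Y.2 + nilMat m Y.1)).2 ⟨_, _, rfl⟩
    obtain ⟨D, hD, hBC⟩ := h.exists_canonical_lie hB hC
    have e := hc.base _ hB _ (h.mem_of_mem _ hC) D hD hBC
    have e' := hc'.base _ hB _ (h.mem_of_mem _ hC) D hD hBC
    have e2 := e.trans e'.symm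
    rw [fundField_apply_basePt (X.2 • K + Φ X.1)] at e2
    have hY : fundField (levi (Y.2 • K + Φ Y.1) Y.2 + nilMat m Y.1) (basePt m) = Y :=
      fundField_apply_basePt _ _ _
    have e3 := sub_apply_eq_of_eq_at cov cov' (isSmoothField_const Y)
      (isSmoothField_fundField (Y.2 • K + Φ Y.1) Y.2 Y.1) hY.symm
    have e4 := congrArg (fun f : RH m →L[ℝ] RH m => f X) e3
    have e5 := e4.trans (sub_eq_zero.2 e2)
    exact sub_eq_zero.1 e5
  have main (u X Y : RH m) : cov (fun u => (Y : TangentSpace 𝓘(ℝ, RH m) u)) u X =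
      cov' (fun u => (Y : TangentSpace 𝓘(ℝ, RH m) u)) u X := by
    obtain ⟨x, hx, -, hx2⟩ := h.exists_exp_mem hF u.2
    obtain ⟨g, hg, e⟩ := exists_mem_grpG_act_eq hx u.1
    have hu : act (g : Mat m) (basePt m) = u := by
      rw [e]
      refine Prod.ext ?_ ?_
      · simp [affMap, basePt]
      · simp [affMap, basePt, hx2]
    obtain ⟨X', rfl⟩ := affLin_surjective x X
    obtain ⟨Y', rfl⟩ := affLin_surjective x Y
    subst hu
    have hst (u : RH m) : (affLin x Y' : RH m) = actDeriv (g : Mat m) u Y' :=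
      (actDeriv_apply e u Y').symm
    have i := hc.invariant g hg _ _ (isSmoothField_const Y') (isSmoothField_const (affLin x Y'))
      hst (basePt m) X'
    have i' := hc'.invariant g hg _ _ (isSmoothField_const Y') (isSmoothField_const (affLin x Y'))
      hst (basePt m) X'
    rw [base] at i
    have i2 := i.trans i'.symm
    have hX := hst (basePt m)
    have e1 : (actDeriv (g : Mat m) (basePt m) X' : RH m) = affLin x X' := actDeriv_apply e _ X'
    rw [e1] at i2
    exact i2
  funext u
  refine ContinuousLinearMap.ext fun X => ?_
  have e3 := sub_apply_eq_of_eq_at cov cov' hσ (isSmoothField_const (σ u)) (u := u) rfl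
  have e4 := congrArg (fun f : RH m →L[ℝ] RH m => f X) e3
  have e5 := e4.trans (sub_eq_zero.2 (main u X (σ u)))
  exact sub_eq_zero.1 e5

theorem curvature_eq (h : IsAdapted F p K Φ) (hF : F ≤ leviGroup m) {cov : AffConn m}
    (hc : IsCanonicalConnection F p cov) {X Y Z : Π u : RH m, Tan u} (hX : IsSmoothField X)
    (hY : IsSmoothField Y) (hZ : IsSmoothField Z) :
    curvature cov X Y Z (basePt m) =
      blockEnd m (curvMat K Φ (X (basePt m)) (Y (basePt m))) (Z (basePt m)) :=
  (curvature_congr_ofChristoffel contDiff_christoffel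
    (fun _ hσ => h.canonicalConnection_unique hF hc (h.isCanonicalConnection hF) hσ)
    hX hY hZ (basePt m)).trans
  (curvature_christoffel_basePt h.commute (isSmoothField_iff.1 hX) (isSmoothField_iff.1 hY)
    (isSmoothField_iff.1 hZ))

theorem map_bracket (h : IsAdapted F p K Φ) (v w : Fin m → ℝ) :
    Φ v * Φ w - Φ w * Φ v = Φ (Φ v *ᵥ w) :=
  (h.map_mulVec (Φ v) (h.map_mem v) w).symm

/-- The Lie algebra `φ(𝔫)`, acting on the tangent space at the base point. -/
def imageAlg (h : IsAdapted F p K Φ) : LieSubalgebra ℝ (Module.End ℝ (Tan (basePt m))) where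
  carrier := Set.range fun w => ((blockEnd m (Φ w) : RH m →L[ℝ] RH m) : RH m →ₗ[ℝ] RH m)
  add_mem' := by
    rintro _ _ ⟨v, rfl⟩ ⟨w, rfl⟩
    exact ⟨v + w, by simp only [map_add]; rfl⟩
  zero_mem' := ⟨0, by simp only [map_zero]; rfl⟩
  smul_mem' := by
    rintro c _ ⟨v, rfl⟩
    exact ⟨c • v, by simp only [map_smul]; rfl⟩
  lie_mem' := by
    rintro _ _ ⟨v, rfl⟩ ⟨w, rfl⟩
    refine ⟨Φ v *ᵥ w, ?_⟩
    refine LinearMap.ext fun u : RH m => ?_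
    change blockEnd m (Φ (Φ v *ᵥ w)) u =
      blockEnd m (Φ v) (blockEnd m (Φ w) u) - blockEnd m (Φ w) (blockEnd m (Φ v) u)
    rw [← h.map_bracket]
    simp [blockEnd_apply]

theorem one_add_injective (hK : Kᵀ = -K) : Function.Injective fun w => w + K *ᵥ w := by
  have key (w : Fin m → ℝ) (hw : w + K *ᵥ w = 0) : w = 0 := by
    have h1 : w ⬝ᵥ (K *ᵥ w) = -(w ⬝ᵥ (K *ᵥ w)) := by
      conv_lhs => rw [Matrix.dotProduct_mulVec, ← Matrix.mulVec_transpose, hK, Matrix.neg_mulVec,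
        neg_dotProduct, dotProduct_comm]
    have h2 : w ⬝ᵥ (w + K *ᵥ w) = 0 := by rw [hw, dotProduct_zero]
    rw [dotProduct_add] at h2
    exact dotProduct_self_eq_zero.1 (by linarith)
  intro v w hvw
  refine sub_eq_zero.1 (key _ ?_)
  have : v + K *ᵥ v = w + K *ᵥ w := hvw
  rw [Matrix.mulVec_sub, sub_add_sub_comm, this, sub_self]

theorem one_add_surjective (hK : Kᵀ = -K) : Function.Surjective fun w => w + K *ᵥ w :=
  LinearMap.surjective_of_injective (f := LinearMap.id + Matrix.mulVecLin K) (one_add_injective hK)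

theorem curvMat_eq (h : IsAdapted F p K Φ) (X Y : RH m) :
    ∃ w, curvMat K Φ X Y = Φ w := by
  refine ⟨X.2 • (Y.1 + K *ᵥ Y.1) - Y.2 • (X.1 + K *ᵥ X.1) + Φ X.1 *ᵥ Y.1, ?_⟩
  rw [curvMat, h.map_bracket]
  simp only [map_add, map_sub, map_smul]

theorem holonomyAlgebra_eq (h : IsAdapted F p K Φ) (hF : F ≤ leviGroup m) {cov : AffConn m}
    (hc : IsCanonicalConnection F p cov) :
    holonomyAlgebra cov (basePt m) = h.imageAlg := by
  refine le_antisymm (LieSubalgebra.lieSpan_le.2 ?_) ?_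
  · rintro T ⟨X, Y, hX, hY, hT⟩
    obtain ⟨w, hw⟩ := h.curvMat_eq (X (basePt m)) (Y (basePt m))
    refine ⟨w, LinearMap.ext fun z : RH m => ?_⟩
    have e := (hT _ (isSmoothField_const z)).trans
      (h.curvature_eq hF hc hX hY (isSmoothField_const z))
    rw [hw] at e
    exact e.symm
  · rintro _ ⟨w, rfl⟩
    obtain ⟨y, rfl⟩ := one_add_surjective h.skew w
    refine LieSubalgebra.subset_lieSpan ⟨_, _, isSmoothField_const ((0, 1) : RH m),
      isSmoothField_const ((y, 0) : RH m), fun Z hZ => ?_⟩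
    have e := h.curvature_eq hF hc (isSmoothField_const ((0, 1) : RH m))
      (isSmoothField_const ((y, 0) : RH m)) hZ
    have e2 : curvMat K Φ ((0, 1) : RH m) ((y, 0) : RH m) = Φ (y + K *ᵥ y) := by
      simp [curvMat]
    rw [e2] at e
    exact e.symm

end IsAdapted

end Adapted

/-! ### Normal form of a reductive decomposition -/

section NormalForm

variable {m : ℕ}

theorem mem_lieCenter_iff {L : LieSubalgebra ℝ (Mat m)} {X : Mat m} :
    X ∈ lieCenter L ↔ X ∈ L ∧ ∀ Y ∈ L, ⁅Y, X⁆ = 0 := by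
  constructor
  · rintro ⟨⟨x, hx⟩, hx', rfl⟩
    refine ⟨hx, fun Y hY => ?_⟩
    have := (LieModule.mem_maxTrivSubmodule (R := ℝ) (L := L) (M := L) ⟨x, hx⟩).1 hx' ⟨Y, hY⟩
    exact congrArg Subtype.val this
  · rintro ⟨hX, h⟩
    refine ⟨⟨X, hX⟩, ?_, rfl⟩
    exact (LieModule.mem_maxTrivSubmodule (R := ℝ) (L := L) (M := L) ⟨X, hX⟩).2
      fun Y => Subtype.ext (h Y Y.2)

theorem mem_lieN (v : Fin m → ℝ) : nilMat m v ∈ lieN m := ⟨v, rfl⟩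

theorem mem_imageN_iff {V W : Submodule ℝ (Mat m)} (f : V →ₗ[ℝ] W) {X : Mat m} :
    X ∈ imageN f ↔ ∃ s : V, (s : Mat m) ∈ lieN m ∧ (f s : Mat m) = X := Iff.rfl

theorem mem_graphOf_iff {V W : Submodule ℝ (Mat m)} (f : V →ₗ[ℝ] W) {X : Mat m} :
    X ∈ graphOf f ↔ ∃ s : V, (s : Mat m) + (f s : Mat m) = X := Iff.rfl

/-- The composition of a linear map into `𝔥` with the upper left block, on `𝔫`. -/
def blockMap {ar : Submodule ℝ (Mat m)} {L : Submodule ℝ (Mat m)}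
    (φ : ↥(ar ⊔ lieN m) →ₗ[ℝ] L) : (Fin m → ℝ) →ₗ[ℝ] Matrix (Fin m) (Fin m) ℝ where
  toFun w := (φ ⟨nilMat m w, Submodule.mem_sup_right (mem_lieN w)⟩ : Mat m).toBlocks₁₁
  map_add' v w := by
    have : (⟨nilMat m (v + w), Submodule.mem_sup_right (mem_lieN _)⟩ : ↥(ar ⊔ lieN m)) =
        ⟨nilMat m v, Submodule.mem_sup_right (mem_lieN v)⟩ +
        ⟨nilMat m w, Submodule.mem_sup_right (mem_lieN w)⟩ := Subtype.ext (map_add _ _ _)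
    rw [this, map_add]
    rfl
  map_smul' c v := by
    have : (⟨nilMat m (c • v), Submodule.mem_sup_right (mem_lieN _)⟩ : ↥(ar ⊔ lieN m)) =
        c • ⟨nilMat m v, Submodule.mem_sup_right (mem_lieN v)⟩ := Subtype.ext (map_smul _ _ _)
    rw [this, map_smul]
    rfl

theorem coe_apply_nilMat {F : Subgroup (GLn m)} {ar : Submodule ℝ (Mat m)}
    (φr : ↥(ar ⊔ lieN m) →ₗ[ℝ] ↥(lieAlg (grpH F)).toSubmodule) (w : Fin m → ℝ)
    (hw : nilMat m w ∈ ar ⊔ lieN m) : (φr ⟨nilMat m w, hw⟩ : Mat m) = levi (blockMap φr w) 0 := by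
  obtain ⟨Z, -, hZ⟩ := exists_of_mem_lieAlg_grpH (φr ⟨nilMat m w, hw⟩).2
  have e : blockMap φr w = Z := by
    change (φr ⟨nilMat m w, hw⟩ : Mat m).toBlocks₁₁ = Z
    rw [hZ, levi, Matrix.toBlocks_fromBlocks₁₁]
  rw [e, hZ]

theorem mem_imageN_iff_blockMap {F : Subgroup (GLn m)} {ar : Submodule ℝ (Mat m)}
    (φr : ↥(ar ⊔ lieN m) →ₗ[ℝ] ↥(lieAlg (grpH F)).toSubmodule) {X : Mat m} :
    X ∈ imageN φr ↔ ∃ w, levi (blockMap φr w) 0 = X := by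
  rw [mem_imageN_iff]
  constructor
  · rintro ⟨⟨_, hs⟩, ⟨w, rfl⟩, rfl⟩
    exact ⟨w, (coe_apply_nilMat φr w hs).symm⟩
  · rintro ⟨w, rfl⟩
    exact ⟨⟨nilMat m w, Submodule.mem_sup_right (mem_lieN w)⟩, mem_lieN w, coe_apply_nilMat φr w _⟩

/-- The line `𝔞_r` is spanned, modulo `𝔫`, by a central element `diag(K, l, -l)` of `𝔣_r`. -/
theorem IsLineAr.exists_central {F : Subgroup (GLn m)} (hF : F ≤ leviGroup m)
    {ar : Submodule ℝ (Mat m)} (har : IsLineAr F ar) :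
    ∃ K l, Kᵀ = -K ∧ l ≠ 0 ∧ levi K l ∈ lieCenter (lieAlg F) ∧ levi K l ∈ ar ⊔ lieN m ∧
      ∀ Y ∈ ar ⊔ lieN m, ∃ (c : ℝ) (v : Fin m → ℝ), Y = c • levi K l + nilMat m v := by
  obtain ⟨X, hX, hX0⟩ := har.proj
  have hX' : X ∈ lieCenter (lieAlg F) ⊔ lieN m := by
    rw [← har.sup_eq]; exact Submodule.mem_sup_left hX
  obtain ⟨A, hA, _, ⟨n, rfl⟩, rfl⟩ := Submodule.mem_sup.1 hX'
  obtain ⟨K, l, hK, rfl⟩ := lieAlg_le_leviAlg hF (mem_lieCenter_iff.1 hA).1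
  refine ⟨K, l, hK, ?_, hA, ?_, fun Y hY => ?_⟩
  · simpa [levi, nilMat] using hX0
  · have := sub_mem (Submodule.mem_sup_left hX : levi K l + nilMat m n ∈ ar ⊔ lieN m)
      (Submodule.mem_sup_right (mem_lieN n))
    simpa using this
  · obtain ⟨Y', hY', _, ⟨v, rfl⟩, rfl⟩ := Submodule.mem_sup.1 hY
    have hne : (⟨_, hX⟩ : ar) ≠ 0 := fun h => by
      have h0 : levi K l + nilMat m n = 0 := congrArg Subtype.val h
      exact hX0 (by rw [h0]; rfl)
    obtain ⟨c, hc⟩ := (finrank_eq_one_iff_of_nonzero' _ hne).1 har.finrank_eq ⟨Y', hY'⟩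
    have hc' : c • (levi K l + nilMat m n) = Y' := congrArg Subtype.val hc
    exact ⟨c, c • n + v, by rw [← hc', map_add, map_smul, smul_add]; abel⟩

theorem exists_isAdapted {F : Subgroup (GLn m)} (hF : IsFactor F)
    {ar : Submodule ℝ (Mat m)} (har : IsLineAr F ar)
    {p : Submodule ℝ (Mat m)} (hp : IsReductiveComplement F p)
    (φr : ↥(ar ⊔ lieN m) →ₗ[ℝ] ↥(lieAlg (grpH F)).toSubmodule)
    (hφr : IsEquivariant (lieAlg (grpH F)) φr) (hgraph : p = graphOf φr) :
    ∃ K, IsAdapted F p K (blockMap φr) := by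
  obtain ⟨K', l, hK', hl, hcen, hmem, hspan⟩ := har.exists_central hF.le_levi
  rw [mem_lieCenter_iff] at hcen
  have hHF : lieAlg (grpH F) ≤ lieAlg F := lieAlg_mono inf_le_left
  set Φ := blockMap φr with hΦ
  have hΦmem (w) : levi (Φ w) 0 ∈ lieAlg (grpH F) := by
    rw [← coe_apply_nilMat φr w (Submodule.mem_sup_right (mem_lieN w))]
    exact (φr _).2
  obtain ⟨S, hS, hφA⟩ := exists_of_mem_lieAlg_grpH (φr ⟨levi K' l, hmem⟩).2
  have hSmem : levi S 0 ∈ lieAlg (grpH F) := hφA ▸ (φr ⟨levi K' l, hmem⟩).2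
  have hScomm : ∀ Z ∈ lieAlg (grpH F), ⁅Z, levi S 0⁆ = 0 := fun Z hZ => by
    have h := hφr Z hZ ⟨levi K' l, hmem⟩ 0 (hcen.2 Z (hHF hZ)).symm
    rw [map_zero, hφA] at h
    exact h.symm
  set K := l⁻¹ • (K' + S) with hKdef
  have hK1 : levi K 1 = l⁻¹ • (levi K' l + levi S 0) := by
    rw [levi_add, smul_levi, add_zero, inv_mul_cancel₀ hl]
  have hl1 (c : ℝ) : levi (c • K) c = (c * l⁻¹) • (levi K' l + levi S 0) := by
    rw [mul_smul, ← hK1, smul_levi, mul_one]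
  have hcomm : ∀ Z, levi Z 0 ∈ lieAlg (grpH F) → Z * K = K * Z := fun Z hZ => by
    have h : ⁅levi Z 0, levi K 1⁆ = 0 := by
      rw [hK1, lie_smul, lie_add, hcen.2 _ (hHF hZ), hScomm _ hZ, add_zero, smul_zero]
    rw [lie_levi_levi] at h
    have h0 : (0 : Mat m) = levi 0 0 := by simpa using (smul_levi (m := m) 0 0 0)
    rw [h0] at h
    exact sub_eq_zero.1 (levi_injective h).1
  have hmem_iff : ∀ X, X ∈ p ↔
      ∃ (c : ℝ) (v : Fin m → ℝ), X = levi (c • K + Φ v) c + nilMat m v := fun X => by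
    have key (c : ℝ) (v : Fin m → ℝ) (hs : c • levi K' l + nilMat m v ∈ ar ⊔ lieN m) :
        (c • levi K' l + nilMat m v) + (φr ⟨c • levi K' l + nilMat m v, hs⟩ : Mat m) =
          levi ((c * l) • K + Φ v) (c * l) + nilMat m v := by
      have e : (⟨c • levi K' l + nilMat m v, hs⟩ : ↥(ar ⊔ lieN m)) =
          c • ⟨levi K' l, hmem⟩ + ⟨nilMat m v, Submodule.mem_sup_right (mem_lieN v)⟩ := rfl
      have e2 : levi ((c * l) • K + Φ v) (c * l) = levi ((c * l) • K) (c * l) + levi (Φ v) 0 := by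
        rw [levi_add, add_zero]
      rw [e, map_add, map_smul, Submodule.coe_add, Submodule.coe_smul, hφA, coe_apply_nilMat, e2,
        hl1, mul_inv_cancel_right₀ hl, smul_add]
      abel
    rw [hgraph, mem_graphOf_iff]
    constructor
    · rintro ⟨⟨s, hs⟩, rfl⟩
      obtain ⟨c, v, rfl⟩ := hspan s hs
      exact ⟨c * l, v, key c v hs⟩
    · rintro ⟨c, v, rfl⟩
      have hs : (c * l⁻¹) • levi K' l + nilMat m v ∈ ar ⊔ lieN m :=
        add_mem (Submodule.smul_mem _ _ hmem) (Submodule.mem_sup_right (mem_lieN v))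
      refine ⟨⟨_, hs⟩, ?_⟩
      have h := key (c * l⁻¹) v hs
      rw [inv_mul_cancel_right₀ hl] at h
      exact h
  have hH (k : Matrix.specialOrthogonalGroup (Fin m) ℝ) (hk : leviHom m (k, 1) ∈ F) :
      leviHom m (k, 1) ∈ grpH F := ⟨hk, mem_rotGroup_iff.2 ⟨k, rfl⟩⟩
  have hconj (k : Matrix.specialOrthogonalGroup (Fin m) ℝ) (hk : leviHom m (k, 1) ∈ F) (c : ℝ)
      (v : Fin m → ℝ) : (k : Matrix (Fin m) (Fin m) ℝ) * (c • K + Φ v) =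
        (c • K + Φ ((k : Matrix (Fin m) (Fin m) ℝ) *ᵥ v)) * (k : Matrix (Fin m) (Fin m) ℝ) := by
    have h := hp.ad_invariant _ (hH k hk) _ ((hmem_iff _).2 ⟨c, v, rfl⟩)
    rw [mul_add, add_mul, leviHom_conj_levi, leviHom_conj_nilMat, hmem_iff] at h
    obtain ⟨c', v', e⟩ := h
    obtain ⟨e1, e2, e3⟩ := levi_add_nilMat_inj e
    rw [← e2, ← e3] at e1
    have e4 := congrArg (· * (k : Matrix (Fin m) (Fin m) ℝ)) e1
    simp only [mul_assoc, specialOrthogonal_transpose_mul, mul_one] at e4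
    simpa using e4
  refine ⟨K, ?_, fun w => skew_of_mem (hΦmem w), fun w => (hcomm _ (hΦmem w)).symm, hmem_iff,
    hΦmem, fun Z hZ v => ?_, fun k hk => ?_, fun k hk v => ?_, ?_, fun X hX => ?_, fun X hX => ?_⟩
  · simp [hKdef, hK', hS, add_comm]
  · have h := hφr _ hZ ⟨nilMat m v, Submodule.mem_sup_right (mem_lieN v)⟩
      ⟨nilMat m (Z *ᵥ v), Submodule.mem_sup_right (mem_lieN _)⟩
      (by rw [lie_levi_nilMat (skew_of_mem hZ)]; simp)
    rw [coe_apply_nilMat, coe_apply_nilMat, lie_levi_levi] at h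
    exact (levi_injective h).1
  · simpa using hconj k hk 1 0
  · simpa using (hconj k hk 0 v).symm
  · refine (mem_lieAlg_iff hF.closed).1 ?_
    rw [hK1]
    exact (lieAlg F).smul_mem _ (add_mem hcen.1 (hHF hSmem))
  · have hX' : X ∈ (lieAlg (grpG F)).toSubmodule := hX
    rw [← hp.sup_eq] at hX'
    obtain ⟨Z, hZ, P, hP, rfl⟩ := Submodule.mem_sup.1 hX'
    obtain ⟨c, v, rfl⟩ := (hmem_iff P).1 hP
    obtain ⟨Z', -, rfl⟩ := exists_of_mem_lieAlg_grpH hZ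
    refine ⟨c, Z' + Φ v, v, ?_, ?_⟩
    · have := add_mem hZ (hΦmem v)
      rwa [levi_add, add_zero] at this
    · rw [← add_assoc, levi_add, zero_add]
      congr 2
      abel
  · have : X ∈ (lieAlg (grpH F)).toSubmodule ⊔ p := Submodule.mem_sup_right hX
    rw [hp.sup_eq] at this
    exact this

theorem injOn_isotropyRep (F : Subgroup (GLn m)) :
    Set.InjOn isotropyRep (lieAlg (grpH F) : Set (Mat m)) := by
  intro X hX Y hY h
  obtain ⟨Z, -, rfl⟩ := exists_of_mem_lieAlg_grpH hX
  obtain ⟨W, -, rfl⟩ := exists_of_mem_lieAlg_grpH hY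
  rw [isotropyRep_levi_zero, isotropyRep_levi_zero] at h
  have key : Z = W := by
    refine Matrix.mulVec_injective (funext fun v => ?_)
    exact congrArg (fun f : RH m →ₗ[ℝ] RH m => (f (v, 0)).1) h
  rw [key]

theorem imageN_comp_eq {U V W : Submodule ℝ (Mat m)} (hU : lieN m ≤ U)
    (φ : V →ₗ[ℝ] W) (χ : U →ₗ[ℝ] V) (hχ : ∀ s : U, (s : Mat m) ∈ lieN m → (χ s : Mat m) = s) :
    imageN φ = imageN (φ ∘ₗ χ) := by
  ext X
  rw [mem_imageN_iff, mem_imageN_iff]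
  constructor
  · rintro ⟨s, hs, rfl⟩
    refine ⟨⟨s, hU hs⟩, hs, ?_⟩
    have e : χ ⟨s, hU hs⟩ = s := Subtype.ext (hχ _ hs)
    rw [LinearMap.comp_apply, e]
  · rintro ⟨s, hs, rfl⟩
    exact ⟨χ s, by rw [hχ s hs]; exact hs, rfl⟩

end NormalForm

end
end RHHol

open RHHol
theorem proposition4p1 (m : ℕ) (F : Subgroup (GLn m)) (hF : IsFactor F)
    (ar : Submodule ℝ (Mat m)) (har : IsLineAr F ar)
    (p : Submodule ℝ (Mat m)) (hp : IsReductiveComplement F p)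
    (φr : ↥(ar ⊔ lieN m) →ₗ[ℝ] ↥(lieAlg (grpH F)).toSubmodule)
    (hφr : IsEquivariant (lieAlg (grpH F)) φr)
    (hgraph : p = graphOf φr)
    (χr : ↥(lieA m ⊔ lieN m) →ₗ[ℝ] ↥(ar ⊔ lieN m))
    (hχr : IsEquivariant (lieAlg (grpH F)) χr)
    (hχrN : ∀ s : ↥(lieA m ⊔ lieN m), (s : Mat m) ∈ lieN m → (χr s : Mat m) = s) :
    (∃ cov : AffConn m, IsCanonicalConnection F p cov) ∧
    Set.InjOn isotropyRep (lieAlg (grpH F) : Set (Mat m)) ∧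
    (∀ cov : AffConn m, IsCanonicalConnection F p cov →
      (holonomyAlgebra cov (basePt m) : Set (Module.End ℝ (Tan (basePt m)))) =
        isotropyRep '' (imageN φr : Set (Mat m))) ∧
    imageN φr = imageN (φr ∘ₗ χr) := by
  obtain ⟨K, h⟩ := exists_isAdapted hF har hp φr hφr hgraph
  refine ⟨⟨_, h.isCanonicalConnection hF.le_levi⟩, injOn_isotropyRep F, fun cov hc => ?_,
    imageN_comp_eq le_sup_right φr χr hχrN⟩
  rw [h.holonomyAlgebra_eq hF.le_levi hc]
  ext T
  constructor
  · rintro ⟨w, rfl⟩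
    exact ⟨_, (mem_imageN_iff_blockMap φr).2 ⟨w, rfl⟩, isotropyRep_levi_zero _⟩
  · rintro ⟨X, hX, rfl⟩
    obtain ⟨w, rfl⟩ := (mem_imageN_iff_blockMap φr).1 hX
    exact ⟨w, (isotropyRep_levi_zero _).symm⟩
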